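/- **Setting.** A block consists of a header (the Merkle root of the payload, the hash of the previous header, metadata) followed by a payload of bits encoding a list of transactions. All blocks have the same length; $\oplus$ is bit-wise XOR. The blockchain consists of $e$ epochs of $k\ge 1$ blocks each. Every droplet node stores $s\ge 1$ droplets per epoch. For each droplet an honest node draws, independently, a degree $d$ from the robust soliton distribution $\mu$ with parameters $c>0$ and $0<\delta<1$, then a uniformly random set of $d$ of the $k$ block indices (the neighbours), and stores this set with the XOR of the $d$ blocks; the same sets are used in all epochs. Here $\mu(d)=(\rho(d)+\theta(d))/\beta$ for $1\le d\le k$, $\beta=\sum_{d=1}^k(\rho(d)+\theta(d))$, $\rho(1)=\frac1k$, $\rho(d)=\frac1{d(d-1)}$ for $d\ge2$, and, with $R=c\sqrt k\ln(k/\delta)$ and $D=\lfloor k/R\rfloor$, $\theta(d)=\frac{R}{dk}$ for $d<D$, $\theta(D)=\frac Rk\ln\frac R\delta$, $\theta(d)=0$ for $d>D$. A bucket node contacts a set of nodes. The adversary controls a set of nodes, which may send arbitrary droplets (values and neighbour sets), or nothing, possibly depending on everything, including the contents of the honest nodes. The adversary is oblivious: the pair of the contacted set and the controlled set, which may be random,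 is independent of the neighbour sets drawn by the nodes. The bucket node knows the true headers. In each epoch the error-resilient peeling decoder repeatedly picks some droplet joined to exactly one block $m$ in the current bipartite graph (a singleton). If the header of its current value equals the $m$-th header and the Merkle root of its payload equals the one stored in that header, block $m$ is decoded to this value, which is XORed into all droplets joined to $m$, and all edges at $m$ are removed; otherwise the droplet is deleted. The decoder fails if there is no singleton while some block is not yet decoded. It recovers the blockchain if, in every epoch and whichever singletons are picked, it ends with all $k$ blocks decoded correctly. The adversary *exhibits a Merkle collision* if, for some droplet sent by a contacted controlled node and some neighbour $m$ of it, XORing away the true blocks of its other neighbours leaves a payload different from that of block $m$ but with the same Merkle root. (This is infeasible for a computationally bounded adversary and a cryptographically secure hash function.) **Lemma.** For every $c>0$ there is a constant $C>0$, depending only on $c$, such that the following holds for all $k\ge1$, $s\ge1$, $0<\delta<1$, all blockchains, hash functions and networks as above, and every such oblivious adversary. If the contacted set contains, almost surely, at least $$\frac1s\left(k+C\sqrt k\,\ln^2(k/\delta)\right)$$ honest nodes, then the probability that the error-resilient peeling decoder fails to recover the entire blockchain is at most $\delta$ plus the probability that the adversary exhibits a Merkle collision. In particular it is at most $\delta$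 if the adversary (being computationally bounded, with a secure hash function) exhibits no Merkle collision. -/

import Mathlib

open MeasureTheory ProbabilityTheory

namespace SeF

/-! ### Blocks, hashes and the blockchain

Bit strings are vectors over `ZMod 2`, so that bit-wise XOR is addition. -/

/-- A header: the Merkle root of the payload, the hash of the previous header (both digests of
`h` bits), and `w` bits of metadata. -/
abbrev Header (h w : ℕ) : Type :=
  (Fin h → ZMod 2) × (Fin h → ZMod 2) × (Fin w → ZMod 2)

/-- A block of `L = (h + h + w) + q` bits: the header bits followed by `q` payload bits.
The addition of this product is the bit-wise XOR of blocks. -/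
abbrev Block (h w q : ℕ) : Type := Header h w × (Fin q → ZMod 2)

/-- The Merkle root stored in a header. -/
def Header.root {h w : ℕ} (H : Header h w) : Fin h → ZMod 2 := H.1

/-- The hash of the previous header stored in a header. -/
def Header.prevHash {h w : ℕ} (H : Header h w) : Fin h → ZMod 2 := H.2.1

/-- The bits of a header, in order. -/
def Header.bits {h w : ℕ} (H : Header h w) : List (ZMod 2) :=
  List.ofFn H.1 ++ List.ofFn H.2.1 ++ List.ofFn H.2.2

/-- One level of a Merkle tree: neighbouring nodes are hashed together in pairs (a last node
without partner moves up unchanged). -/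
def merkleLevel {h : ℕ} (hash : List (ZMod 2) → (Fin h → ZMod 2)) :
    List (Fin h → ZMod 2) → List (Fin h → ZMod 2)
  | [] => []
  | [a] => [a]
  | a :: b :: t => hash (List.ofFn a ++ List.ofFn b) :: merkleLevel hash t

/-- The Merkle root of a list of items: the items are hashed, and levels are formed until a single
node is left. -/
def merkleRoot {h : ℕ} (hash : List (ZMod 2) → (Fin h → ZMod 2))
    (items : List (List (ZMod 2))) : Fin h → ZMod 2 :=
  ((merkleLevel hash)^[items.length] (items.map hash)).headD 0

/-- The Merkle root of a payload; `txs` reads the payload bits as a list of transactions. -/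
def payloadRoot {h q : ℕ} (hash : List (ZMod 2) → (Fin h → ZMod 2))
    (txs : (Fin q → ZMod 2) ↪ List (List (ZMod 2))) (p : Fin q → ZMod 2) : Fin h → ZMod 2 :=
  merkleRoot hash (txs p)

/-- The first `t` blocks of `B` form a blockchain: every header stores the Merkle root of its
payload and the hash of the preceding header. -/
structure IsBlockchain {h w q : ℕ} (hash : List (ZMod 2) → (Fin h → ZMod 2))
    (txs : (Fin q → ZMod 2) ↪ List (List (ZMod 2))) (t : ℕ) (B : ℕ → Block h w q) : Prop where
  root_eq : ∀ i < t, Header.root (B i).1 = payloadRoot hash txs (B i).2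
  prevHash_eq : ∀ i, i + 1 < t → Header.prevHash (B (i + 1)).1 = hash (Header.bits (B i).1)

/-- Block `m` of epoch `l`, for epochs of `k` blocks. -/
def epochBlock {h w q : ℕ} (B : ℕ → Block h w q) (k l : ℕ) (m : Fin k) : Block h w q :=
  B (l * k + m)

/-! ### The encoder -/

/-- The ideal soliton function `ρ`. -/
noncomputable def rho (k d : ℕ) : ℝ :=
  if d = 1 then 1 / k else 1 / (d * (d - 1))

/-- `R = c √k ln(k/δ)`. -/
noncomputable def solitonR (k : ℕ) (c δ : ℝ) : ℝ := c * √k * Real.log (k / δ)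

/-- The function `θ`; the position `k / R` of the spike is rounded down to an integer. -/
noncomputable def theta (k : ℕ) (c δ : ℝ) (d : ℕ) : ℝ :=
  if d < ⌊k / solitonR k c δ⌋₊ then solitonR k c δ / (d * k)
  else if d = ⌊k / solitonR k c δ⌋₊ then
    solitonR k c δ / k * Real.log (solitonR k c δ / δ)
  else 0

/-- The normalization `β`. -/
noncomputable def beta (k : ℕ) (c δ : ℝ) : ℝ := ∑ d ∈ Finset.Icc 1 k, (rho k d + theta k c δ d)

/-- The robust soliton distribution, for `d = 1, …, k`. -/
noncomputable def robustSoliton (k : ℕ) (c δ : ℝ) (d : ℕ) : ℝ :=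
  (rho k d + theta k c δ d) / beta k c δ

/-- The law of the set of neighbours of an honest droplet: the degree `d` has the robust soliton
distribution, and given `d` the neighbours are a uniformly random `d`-element set of blocks. -/
noncomputable def neighborLaw (k : ℕ) (c δ : ℝ) : Measure (Finset (Fin k)) :=
  ∑ d ∈ Finset.Icc 1 k, ENNReal.ofReal (robustSoliton k c δ d) •
    uniformOn {S : Finset (Fin k) | S.card = d}

/-- A stored droplet: a coded block, and the support of the length-`k` binary vector that tells
which blocks were combined. -/
structure Droplet (h w q k : ℕ) where
  value : Block h w q
  nbrs : Finset (Fin k)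

/-- The droplet that an honest node computes from the blocks `b` of an epoch and the neighbours
`S`. -/
def encode {h w q k : ℕ} (b : Fin k → Block h w q) (S : Finset (Fin k)) : Droplet h w q k :=
  ⟨∑ m ∈ S, b m, S⟩

/-! ### The error-resilient peeling decoder -/

/-- State of the decoder: the current values of the droplets, the current bipartite graph (given by
the blocks to which each droplet is connected), and the blocks decoded so far (`none` is NULL). -/
structure PeelState (h w q k : ℕ) (ι : Type*) where
  value : ι → Block h w q
  nbrs : ι → Finset (Fin k)
  decoded : Fin k → Option (Block h w q)

/-- The initial state for the downloaded droplets; `none` stands for a droplet that was not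
received, and is a vertex without edges. -/
def initState {h w q k : ℕ} {ι : Type*} (D : ι → Option (Droplet h w q k)) :
    PeelState h w q k ι where
  value i := ((D i).map Droplet.value).getD 0
  nbrs i := ((D i).map Droplet.nbrs).getD ∅
  decoded _ := none

/-- The test applied to a singleton `v` against the header `H` of the block it is connected to. -/
def Matches {h w q : ℕ} (hash : List (ZMod 2) → (Fin h → ZMod 2))
    (txs : (Fin q → ZMod 2) ↪ List (List (ZMod 2))) (H : Header h w) (v : Block h w q) : Prop :=
  v.1 = H ∧ payloadRoot hash txs v.2 = Header.root H

/-- The state after the singleton `i`, connected to block `m`, is accepted: block `m` is decoded, its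
contribution is removed from all droplets connected to it, and all edges at `m` are removed. -/
def PeelState.accept {h w q k : ℕ} {ι : Type*} (σ : PeelState h w q k ι) (i : ι) (m : Fin k) :
    PeelState h w q k ι where
  value i' := if m ∈ σ.nbrs i' then σ.value i' + σ.value i else σ.value i'
  nbrs i' := (σ.nbrs i').erase m
  decoded := Function.update σ.decoded m (some (σ.value i))

/-- The state after the droplet `i` is rejected: it is deleted with all its edges. -/
def PeelState.reject {h w q k : ℕ} {ι : Type*} [DecidableEq ι] (σ : PeelState h w q k ι) (i : ι) :
    PeelState h w q k ι :=
  { σ with nbrs := Function.update σ.nbrs i ∅ }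

/-- One iteration of the decoder with headers `H`: some singleton is accepted or rejected. -/
inductive PeelStep {h w q k : ℕ} {ι : Type*} [DecidableEq ι]
    (hash : List (ZMod 2) → (Fin h → ZMod 2)) (txs : (Fin q → ZMod 2) ↪ List (List (ZMod 2)))
    (H : Fin k → Header h w) (σ : PeelState h w q k ι) : PeelState h w q k ι → Prop
  | accept (i : ι) (m : Fin k) (hs : σ.nbrs i = {m}) (hm : Matches hash txs (H m) (σ.value i)) :
      PeelStep hash txs H σ (σ.accept i m)
  | reject (i : ι) (m : Fin k) (hs : σ.nbrs i = {m}) (hm : ¬ Matches hash txs (H m) (σ.value i)) :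
      PeelStep hash txs H σ (σ.reject i)

/-- The decoder, run from a state and whichever singletons it selects, stops after finitely many
iterations with all blocks decoded and equal to `b`. (It never halts for lack of a singleton.) -/
inductive Recovers {h w q k : ℕ} {ι : Type*} [DecidableEq ι]
    (hash : List (ZMod 2) → (Fin h → ZMod 2)) (txs : (Fin q → ZMod 2) ↪ List (List (ZMod 2)))
    (H : Fin k → Header h w) (b : Fin k → Block h w q) : PeelState h w q k ι → Prop
  | done (σ : PeelState h w q k ι) (hσ : ∀ m, σ.decoded m = some (b m)) :
      Recovers hash txs H b σ
  | step (σ : PeelState h w q k ι) (hn : ∃ m, σ.decoded m = none)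
      (hex : ∃ σ', PeelStep hash txs H σ σ')
      (hall : ∀ σ', PeelStep hash txs H σ σ' → Recovers hash txs H b σ') :
      Recovers hash txs H b σ

/-! ### Bootstrap in the presence of an adversary -/

/-- What the bucket node downloads for one epoch with blocks `b`, when it contacts the nodes in `T`
and the adversary controls the nodes in `A`: an honest node `j` sends its `s` droplets, with
neighbours `V (j, p)`, and a controlled node sends anything, or nothing. -/
def download {h w q k s : ℕ} {J : Type*} [DecidableEq J] (b : Fin k → Block h w q)
    (T A : Finset J) (V : J × Fin s → Finset (Fin k))
    (adv : J × Fin s → Option (Droplet h w q k)) (i : J × Fin s) : Option (Droplet h w q k) :=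
  if i.1 ∈ T then (if i.1 ∈ A then adv i else some (encode b (V i))) else none

/-- The whole blockchain of `e` epochs is recovered from the contacted nodes. In epoch `l` the
controlled nodes send `adv l`; the honest nodes use the same neighbours in all epochs. -/
def RecoversChain {h w q k s : ℕ} {J : Type*} [DecidableEq J]
    (hash : List (ZMod 2) → (Fin h → ZMod 2)) (txs : (Fin q → ZMod 2) ↪ List (List (ZMod 2)))
    (e : ℕ) (B : ℕ → Block h w q) (T A : Finset J) (V : J × Fin s → Finset (Fin k))
    (adv : Fin e → J × Fin s → Option (Droplet h w q k)) : Prop :=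
  ∀ l : Fin e, Recovers hash txs (fun m => (epochBlock B k l m).1) (epochBlock B k l)
    (initState (download (epochBlock B k l) T A V (adv l)))

/-- The adversary has broken the hash function: some droplet sent by a contacted controlled node
turns, when the true blocks of all its neighbours except `m` are removed from it, into a payload
that differs from the payload of block `m` but has the same Merkle root. -/
def ExhibitsCollision {h w q k s : ℕ} {J : Type*}
    (hash : List (ZMod 2) → (Fin h → ZMod 2)) (txs : (Fin q → ZMod 2) ↪ List (List (ZMod 2)))
    (e : ℕ) (B : ℕ → Block h w q) (T A : Finset J)
    (adv : Fin e → J × Fin s → Option (Droplet h w q k)) : Prop :=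
  ∃ (l : Fin e) (i : J × Fin s) (D : Droplet h w q k) (m : Fin k),
    i.1 ∈ T ∧ i.1 ∈ A ∧ adv l i = some D ∧ m ∈ D.nbrs ∧
    (D.value + ∑ m' ∈ D.nbrs.erase m, epochBlock B k l m').2 ≠ (epochBlock B k l m).2 ∧
    payloadRoot hash txs (D.value + ∑ m' ∈ D.nbrs.erase m, epochBlock B k l m').2 =
      payloadRoot hash txs (epochBlock B k l m).2

end SeF

/-! The argument has a deterministic half and a probabilistic half. As long as all decoded blocks
are correct, the value of a singleton is the original droplet with all its neighbours but one
removed, in whatever order this happened. Hence, without a Merkle collision, no false value is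
accepted and no honest droplet is rejected, and the decoder can stall only on a stopping set: a
nonempty set `U` of blocks that no honest neighbour set meets in exactly one element
(`recovers_of_isSound`). This event involves only the neighbour sets, so it is the same for all
epochs and all adversarial messages. Obliviousness lets one fix the honest droplets, `n` in number
(`prob_not_recoversChain_le`).

For the probability of a stopping set, the plain union bound over all `U` of size `u` costs
`k.choose u`, roughly `(e k / u) ^ u`, and the factor `e ^ u` is too much for larger `u`. Instead,
peeling is run until it halts at a residual set `X` of size `u`. Every `j`-subset `W` of `X` has
then remained uncovered during `k - u` removals. Averaging over these subsets gives the bound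
`choose k j / choose u j * (1 - j q) ^ n`, where `q` is the probability that a given vertex of a
`u`-set is the only neighbour in that set (`sum_stopping_le`). The vertices are removed in an order
that depends on the droplets; `sum_survives_le` shows, by a martingale-like weight, that this is no
worse than a fixed order.

For `j` small compared with `u` the quotient of binomials is at most `(k / u) ^ j * exp (j ^ 2 /
u)`. The ideal soliton part yields `n q ≥ log (k / u)` (`sum_rho_mul_choose`), which cancels `(k /
u) ^ j`. The part `θ` pays for the rest: its spike for small `u`, where `j = u`, and its lower
degrees for large `u`, where `j` is about `min u R / 8`. This is `sum_le_of_four_mul_le`; cruder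
estimates handle bounded `k` and `R > k / 4`. -/

namespace SeF

/-! ### Peeling and stopping sets -/

section Peeling

open Finset

variable {α ι : Type*} [Fintype α] [DecidableEq α] [Fintype ι] [DecidableEq ι]

/-- The vertices that are the only neighbour outside `V` of some droplet. -/
def covered (V : Finset α) (f : ι → Finset α) : Finset α :=
  {v | ∃ i, f i \ V = {v}}

omit [DecidableEq ι] in
lemma mem_covered {V : Finset α} {f : ι → Finset α} {v : α} :
    v ∈ covered V f ↔ ∃ i, f i \ V = {v} := by
  simp [covered]

omit [DecidableEq ι] in
lemma notMem_of_mem_covered {V : Finset α} {f : ι → Finset α} {v : α} (h : v ∈ covered V f) :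
    v ∉ V := by
  obtain ⟨i, hi⟩ := mem_covered.1 h
  have : v ∈ f i \ V := by simp [hi]
  exact (mem_sdiff.1 this).2

/-- No droplet has an element of `W` as its only neighbour outside `V`. -/
def NoHit (W V : Finset α) (f : ι → Finset α) : Prop := ∀ i, ∀ w ∈ W, f i \ V ≠ {w}

/-- Peeling, started when the vertices of `V` are removed, runs for `r` more steps, and no element
of `W` is covered before or after any of them. -/
def Survives (pick : Finset α → α) (W : Finset α) : ℕ → Finset α → (ι → Finset α) → Prop
  | 0, V, f => NoHit W V f
  | r + 1, V, f => NoHit W V f ∧ (covered V f).Nonempty ∧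
      Survives pick W r (insert (pick (covered V f)) V) f

omit [DecidableEq ι] in
lemma Survives.noHit {pick : Finset α → α} {W V : Finset α} {f : ι → Finset α} {r : ℕ}
    (h : Survives pick W r V f) : NoHit W V f := by
  cases r with
  | zero => exact h
  | succ r => exact h.1

omit [DecidableEq ι] in
/-- If `U` is a stopping set, peeling halts with a residual set that contains `U`. -/
lemma exists_residual (pick : Finset α → α) (hpick : ∀ C : Finset α, C.Nonempty → pick C ∈ C)
    {U : Finset α} {f : ι → Finset α} (hU : ∀ i, (f i ∩ U).card ≠ 1) (n : ℕ) :
    ∀ V : Finset α, Fintype.card α - V.card ≤ n → Disjoint V U →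
      ∃ X : Finset α, U ⊆ X ∧ Disjoint V X ∧
        ∀ W ⊆ X, Survives pick W (Fintype.card α - X.card - V.card) V f := by
  induction n with
  | zero =>
    intro V hV hd
    have h1 : V.card ≤ Fintype.card α := card_le_univ V
    have h2 : V = univ := by
      rw [← card_eq_iff_eq_univ]; omega
    subst h2
    have hU0 : U = ∅ := by
      rw [← top_eq_univ, top_disjoint] at hd; exact hd
    subst hU0
    refine ⟨∅, le_rfl, disjoint_empty_right _, fun W hW => ?_⟩
    simp only [card_empty, card_univ, Nat.sub_zero, Nat.sub_self]
    intro i w hw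
    exact absurd (hW hw) (notMem_empty w)
  | succ n ih =>
    intro V hV hd
    by_cases hc : (covered V f).Nonempty
    · have hv := hpick _ hc
      set v := pick (covered V f) with hvdef
      have hvV := notMem_of_mem_covered hv
      have hvU : v ∉ U := by
        intro hvU
        -- Since `V` misses `U`, a covered vertex in `U` would be the whole of `f i ∩ U`.
        obtain ⟨i, hi⟩ := mem_covered.1 hv
        apply hU i
        rw [card_eq_one]
        refine ⟨v, ?_⟩
        ext x
        have hx : x ∈ f i \ V ↔ x = v := by rw [hi, mem_singleton]
        have hxU : x ∈ U → x ∉ V := fun h h' => disjoint_left.1 hd h' h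
        simp only [mem_inter, mem_singleton, mem_sdiff] at hx ⊢
        constructor
        · rintro ⟨h1, h2⟩
          exact hx.1 ⟨h1, hxU h2⟩
        · intro h
          exact ⟨(hx.2 h).1, h ▸ hvU⟩
      have hcard : (insert v V).card = V.card + 1 := card_insert_of_notMem hvV
      obtain ⟨X, hUX, hdX, hX⟩ := ih (insert v V) (by omega)
        (by rw [disjoint_insert_left]; exact ⟨hvU, hd⟩)
      rw [disjoint_insert_left] at hdX
      refine ⟨X, hUX, hdX.2, fun W hW => ?_⟩
      have hle : (insert v V).card + X.card ≤ Fintype.card α := by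
        rw [← card_union_of_disjoint (by rw [disjoint_insert_left]; exact hdX)]
        exact card_le_univ _
      obtain ⟨r, hr⟩ : ∃ r, Fintype.card α - X.card - V.card = r + 1 :=
        ⟨Fintype.card α - X.card - V.card - 1, by omega⟩
      have hr' : Fintype.card α - X.card - (insert v V).card = r := by omega
      have hs := hX W hW
      rw [hr'] at hs
      rw [hr]
      refine ⟨?_, hc, hs⟩
      intro i w hw hi
      -- A covered vertex stays covered until it is itself removed, so a hit on `W` now would still
      -- be one after the removal of `v`.
      refine hs.noHit i w hw ?_
      have hwX := hW hw
      rw [sdiff_insert, hi]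
      refine erase_eq_of_notMem ?_
      rw [mem_singleton]
      rintro rfl
      exact hdX.1 hwX
    -- Nothing is covered, so peeling has halted and everything left is residual; zero steps remain.
    · refine ⟨Vᶜ, ?_, disjoint_compl_right, fun W hW => ?_⟩
      · intro x hx
        rw [mem_compl]
        exact fun h => disjoint_left.1 hd h hx
      · have : Fintype.card α - Vᶜ.card - V.card = 0 := by
          rw [card_compl]; have := card_le_univ V; omega
        rw [this]
        intro i w _ hi
        exact hc ⟨w, mem_covered.2 ⟨i, hi⟩⟩

/-- What is known about a droplet once the vertices of `V` are removed: its neighbours, if at most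
one of them remains. -/
def reveal (V S : Finset α) : Option (Finset α) := if (S \ V).card ≤ 1 then some S else none

omit [Fintype α] in
lemma reveal_eq_none {V S : Finset α} : reveal V S = none ↔ 2 ≤ (S \ V).card := by
  unfold reveal; split_ifs with h <;> simp <;> omega

omit [Fintype α] in
lemma reveal_eq_some {V S S' : Finset α} :
    reveal V S = some S' ↔ (S \ V).card ≤ 1 ∧ S = S' := by
  unfold reveal; split_ifs with h <;> simp [h]

omit [DecidableEq ι] in
-- The choice of the next vertex uses only revealed information; this is what makes the peeling
-- order adapted to `reveal`.
lemma covered_congr {V : Finset α} {f f' : ι → Finset α}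
    (h : ∀ i, reveal V (f i) = reveal V (f' i)) : covered V f = covered V f' := by
  have key : ∀ {f f' : ι → Finset α}, (∀ i, reveal V (f i) = reveal V (f' i)) →
      covered V f ⊆ covered V f' := by
    intro f f' h v hv
    obtain ⟨i, hi⟩ := mem_covered.1 hv
    refine mem_covered.2 ⟨i, ?_⟩
    have h1 : reveal V (f i) = some (f i) := by
      rw [reveal_eq_some, hi]; simp
    rw [h i, reveal_eq_some] at h1
    rw [h1.2, hi]
  exact Subset.antisymm (key h) (key fun i => (h i).symm)

/-- The total weight of the continuations, up to the removal of `t` vertices, that do not cover `W`,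
for a droplet about which `x` is known. -/
noncomputable def weight (ω : Finset α → ℝ) (q : ℕ → ℝ) (W : Finset α) (t : ℕ) (V : Finset α) :
    Option (Finset α) → ℝ
  | some S => if ∃ w ∈ W, S \ V = {w} then 0 else ω S
  -- For a fixed order avoiding `W`, sets that hit `W` after `V` still hit it after `t` removals. So
  -- the hits at time `t` among the sets not yet revealed weigh `W.card * (q t - q V.card)`.
  | none => ∑ S with 2 ≤ (S \ V).card, ω S - W.card * (q t - q V.card)

/-- What can be known about a droplet after the removal of `v`, when `x` is known before. -/
def refinements (V : Finset α) (v : α) : Option (Finset α) → Finset (Option (Finset α))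
  | some S => {some S}
  | none => insert none
      (({S | 2 ≤ (S \ V).card ∧ (S \ insert v V).card ≤ 1} : Finset (Finset α)).image some)

lemma reveal_mem_refine (V : Finset α) (v : α) (S : Finset α) :
    reveal (insert v V) S ∈ refinements V v (reveal V S) := by
  have hsub : S \ insert v V ⊆ S \ V := sdiff_subset_sdiff le_rfl (subset_insert v V)
  have hle := card_le_card hsub
  by_cases h : (S \ V).card ≤ 1
  · have h1 : reveal V S = some S := reveal_eq_some.2 ⟨h, rfl⟩
    have h2 : reveal (insert v V) S = some S := reveal_eq_some.2 ⟨by omega, rfl⟩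
    rw [h1, h2]; simp [refinements]
  · have h1 : reveal V S = none := reveal_eq_none.2 (by omega)
    rw [h1]
    by_cases h' : (S \ insert v V).card ≤ 1
    · have h2 : reveal (insert v V) S = some S := reveal_eq_some.2 ⟨h', rfl⟩
      rw [h2]
      simp only [refinements, mem_insert, mem_image, mem_filter, mem_univ, true_and]
      exact Or.inr ⟨S, ⟨by omega, h'⟩, rfl⟩
    · have h2 : reveal (insert v V) S = none := reveal_eq_none.2 (by omega)
      rw [h2]; simp [refinements]

/-! ### Comparison of adaptive peeling with a fixed order of removal -/

section Weights

variable {ω : Finset α → ℝ} {q : ℕ → ℝ}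

lemma sum_hit_eq (hq : ∀ (V : Finset α) (w : α), w ∉ V → ∑ S with S \ V = {w}, ω S = q V.card)
    {V W : Finset α} (hVW : Disjoint V W) :
    ∑ S with ∃ w ∈ W, S \ V = {w}, ω S = W.card * q V.card := by
  have h1 : (univ.filter fun S : Finset α => ∃ w ∈ W, S \ V = {w}) =
      W.biUnion fun w => univ.filter fun S => S \ V = {w} := by
    ext S; simp
  rw [h1, sum_biUnion]
  · rw [sum_congr rfl fun w hw => hq V w fun h => disjoint_left.1 hVW h hw]
    simp
  · intro w _ w' _ hne
    rw [Function.onFun, disjoint_left]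
    intro S hS hS'
    simp only [mem_filter, mem_univ, true_and] at hS hS'
    exact hne (singleton_injective (hS.symm.trans hS'))

/-- The martingale property of `weight`. Hits after the removal of `v` come from earlier hits or
from sets that were unrevealed, which gives an identity for each single `S`; summing it,
`sum_hit_eq` turns the hits into `q`. -/
lemma sum_refine_none (hq : ∀ (V : Finset α) (w : α), w ∉ V → ∑ S with S \ V = {w}, ω S = q V.card)
    {V W : Finset α} (t : ℕ) (hVW : Disjoint V W) {v : α} (hvV : v ∉ V) (hvW : v ∉ W) :
    ∑ y ∈ refinements V v none, weight ω q W t (insert v V) y = weight ω q W t V none := by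
  have hd' : Disjoint (insert v V) W := by rw [disjoint_insert_left]; exact ⟨hvW, hVW⟩
  have hcard : (insert v V).card = V.card + 1 := card_insert_of_notMem hvV
  have hnone : (none : Option (Finset α)) ∉
      (({S | 2 ≤ (S \ V).card ∧ (S \ insert v V).card ≤ 1} : Finset (Finset α)).image some) := by
    simp
  have e1 := sum_hit_eq hq hVW
  have e2 := sum_hit_eq hq hd'
  simp only [refinements]
  rw [sum_insert hnone, sum_image (by simp)]
  simp only [weight]
  -- the four sums as sums over all sets
  simp only [sum_filter] at e1 e2 ⊢
  rw [hcard] at e2 ⊢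
  have key : ∀ S : Finset α,
      (if 2 ≤ (S \ insert v V).card then ω S else 0) +
        (if 2 ≤ (S \ V).card ∧ (S \ insert v V).card ≤ 1 then
          (if ∃ w ∈ W, S \ insert v V = {w} then 0 else ω S) else 0) +
        (if ∃ w ∈ W, S \ insert v V = {w} then ω S else 0) =
      (if 2 ≤ (S \ V).card then ω S else 0) + (if ∃ w ∈ W, S \ V = {w} then ω S else 0) := by
    intro S
    have hle : (S \ insert v V).card ≤ (S \ V).card :=
      card_le_card (sdiff_subset_sdiff le_rfl (subset_insert v V))
    have hhit : (∃ w ∈ W, S \ insert v V = {w}) →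
        2 ≤ (S \ V).card ∨ ∃ w ∈ W, S \ V = {w} := by
      rintro ⟨w, hw, h⟩
      have hle2 : (S \ V).card ≤ 1 → S \ V = {w} := by
        intro hle1
        have hsub : ({w} : Finset α) ⊆ S \ V := by
          rw [← h]; exact sdiff_subset_sdiff le_rfl (subset_insert v V)
        exact (eq_of_subset_of_card_le hsub (by simpa using hle1)).symm
      by_cases h1 : (S \ V).card ≤ 1
      · exact Or.inr ⟨w, hw, hle2 h1⟩
      · left; omega
    have hhit1 : (∃ w ∈ W, S \ insert v V = {w}) → (S \ insert v V).card = 1 := by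
      rintro ⟨w, hw, h⟩
      rw [h, card_singleton]
    have hhit2 : (∃ w ∈ W, S \ V = {w}) → (S \ V).card = 1 ∧ ∃ w ∈ W, S \ insert v V = {w} := by
      rintro ⟨w, hw, h⟩
      refine ⟨by rw [h, card_singleton], w, hw, ?_⟩
      rw [sdiff_insert, h]
      refine erase_eq_of_notMem ?_
      rw [mem_singleton]
      rintro rfl
      exact hvW hw
    by_cases a : ∃ w ∈ W, S \ insert v V = {w}
    · have a1 := hhit1 a
      by_cases b : ∃ w ∈ W, S \ V = {w}
      · have b1 := (hhit2 b).1
        simp only [a, b, a1, b1]; norm_num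
      · have b1 := (hhit a).resolve_right b
        simp only [a, b, a1, b1]; norm_num
    · have b : ¬ ∃ w ∈ W, S \ V = {w} := fun b => a (hhit2 b).2
      by_cases h2 : 2 ≤ (S \ insert v V).card
      · have h3 : 2 ≤ (S \ V).card := by omega
        have h4 : ¬ (S \ insert v V).card ≤ 1 := by omega
        simp only [a, b, h2, h3, h4]; norm_num
      · have h4 : (S \ insert v V).card ≤ 1 := by omega
        by_cases h3 : 2 ≤ (S \ V).card <;>
        · simp only [a, b, h2, h3, h4]; norm_num
  have hs := sum_congr (rfl : (univ : Finset (Finset α)) = univ) fun S _ => key S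
  simp only [sum_add_distrib] at hs
  rw [e1, e2] at hs
  linarith

/-- The subtraction hides the sign. It vanishes when `V.card = t`, and `sum_refine_none` carries
nonnegativity backwards; `t + W.card ≤ Fintype.card α` provides a vertex outside `V ∪ W` to remove.
-/
lemma weight_none_nonneg
    (hq : ∀ (V : Finset α) (w : α), w ∉ V → ∑ S with S \ V = {w}, ω S = q V.card)
    (hω : ∀ S, 0 ≤ ω S) {W : Finset α} {t : ℕ} (ht : t + W.card ≤ Fintype.card α) (r : ℕ) :
    ∀ V : Finset α, Disjoint V W → V.card + r = t → 0 ≤ weight ω q W t V none := by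
  induction r with
  | zero =>
    intro V _ hV
    simp only [weight]
    rw [← hV]
    simp only [add_zero, sub_self, mul_zero, sub_zero]
    exact sum_nonneg fun S _ => hω S
  | succ r ih =>
    intro V hd hV
    obtain ⟨v, hv⟩ : ∃ v, v ∉ V ∪ W := by
      by_contra! h
      have : V ∪ W = univ := eq_univ_iff_forall.2 h
      have h2 : (V ∪ W).card = V.card + W.card := card_union_of_disjoint hd
      rw [this, card_univ] at h2
      omega
    rw [mem_union, not_or] at hv
    rw [← sum_refine_none hq t hd hv.1 hv.2]
    simp only [refinements]
    have hnone : (none : Option (Finset α)) ∉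
        (({S | 2 ≤ (S \ V).card ∧ (S \ insert v V).card ≤ 1} : Finset (Finset α)).image some) := by
      simp
    rw [sum_insert hnone, sum_image (by simp)]
    refine add_nonneg (ih _ ?_ ?_) (sum_nonneg fun S _ => ?_)
    · rw [disjoint_insert_left]; exact ⟨hv.2, hd⟩
    · rw [card_insert_of_notMem hv.1]; omega
    · simp only [weight]
      split_ifs
      · exact le_rfl
      · exact hω S

lemma weight_nonneg
    (hq : ∀ (V : Finset α) (w : α), w ∉ V → ∑ S with S \ V = {w}, ω S = q V.card)
    (hω : ∀ S, 0 ≤ ω S) {W : Finset α} {t : ℕ} (ht : t + W.card ≤ Fintype.card α)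
    {V : Finset α} (hd : Disjoint V W) (hV : V.card ≤ t) (x : Option (Finset α)) :
    0 ≤ weight ω q W t V x := by
  cases x with
  | none => exact weight_none_nonneg hq hω ht (t - V.card) V hd (by omega)
  | some S =>
    simp only [weight]
    split_ifs
    · exact le_rfl
    · exact hω S

lemma sum_refine_le
    (hq : ∀ (V : Finset α) (w : α), w ∉ V → ∑ S with S \ V = {w}, ω S = q V.card)
    (hω : ∀ S, 0 ≤ ω S)
    {V W : Finset α} (t : ℕ) (hVW : Disjoint V W) {v : α} (hvV : v ∉ V) (hvW : v ∉ W)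
    (x : Option (Finset α)) :
    ∑ y ∈ refinements V v x, weight ω q W t (insert v V) y ≤ weight ω q W t V x := by
  cases x with
  | none => exact (sum_refine_none hq t hVW hvV hvW).le
  | some S =>
    simp only [refinements, sum_singleton, weight]
    by_cases h : ∃ w ∈ W, S \ V = {w}
    · have h' : ∃ w ∈ W, S \ insert v V = {w} := by
        obtain ⟨w, hw, h⟩ := h
        refine ⟨w, hw, ?_⟩
        rw [sdiff_insert, h]
        refine erase_eq_of_notMem ?_
        rw [mem_singleton]
        rintro rfl
        exact hvW hw
      rw [if_pos h, if_pos h']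
    · rw [if_neg h]
      split_ifs
      · exact hω S
      · exact le_rfl

open Classical in
/-- Given what is known when the vertices of `V` are removed, peeling up to the removal of `t`
vertices without covering `W` is at most as likely as for a peeling order fixed in advance. -/
lemma sum_survives_le (pick : Finset α → α) (hpick : ∀ C : Finset α, C.Nonempty → pick C ∈ C)
    (hq : ∀ (V : Finset α) (w : α), w ∉ V → ∑ S with S \ V = {w}, ω S = q V.card)
    (hω : ∀ S, 0 ≤ ω S) {W : Finset α} {t : ℕ} (ht : t + W.card ≤ Fintype.card α) (r : ℕ) :
    ∀ V : Finset α, Disjoint V W → V.card + r = t → ∀ x : ι → Option (Finset α),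
      ∑ f : ι → Finset α with (∀ i, reveal V (f i) = x i),
        (if Survives pick W r V f then ∏ i, ω (f i) else 0) ≤ ∏ i, weight ω q W t V (x i) := by
  induction r with
  | zero =>
    intro V hd hV x
    have e1 : (univ.filter fun f : ι → Finset α => ∀ i, reveal V (f i) = x i) =
        Fintype.piFinset fun i => univ.filter fun S => reveal V S = x i := by
      ext f; simp
    calc _ ≤ ∑ f : ι → Finset α with (∀ i, reveal V (f i) = x i),
          ∏ i, (if ∃ w ∈ W, f i \ V = {w} then 0 else ω (f i)) := by
          refine sum_le_sum fun f _ => ?_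
          have hnn : 0 ≤ ∏ i, (if ∃ w ∈ W, f i \ V = {w} then 0 else ω (f i)) :=
            prod_nonneg fun i _ => by split_ifs; exacts [le_rfl, hω _]
          split_ifs with hs
          · refine le_of_eq (prod_congr rfl fun i _ => ?_)
            rw [if_neg]
            rintro ⟨w, hw, h⟩
            exact hs i w hw h
          · exact hnn
      _ = ∏ i, ∑ S with reveal V S = x i, (if ∃ w ∈ W, S \ V = {w} then 0 else ω S) := by
          rw [e1, prod_univ_sum]
      _ ≤ _ := by
          refine prod_le_prod (fun i _ => sum_nonneg fun S _ => ?_) fun i _ => ?_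
          · split_ifs; exacts [le_rfl, hω _]
          · have hw := weight_nonneg hq hω ht hd (by omega) (x i)
            cases hx : x i with
            | none =>
              simp only [reveal_eq_none, weight]
              rw [← hV]
              simp only [add_zero, sub_self, mul_zero, sub_zero]
              refine sum_le_sum fun S _ => ?_
              split_ifs; exacts [hω _, le_rfl]
            | some S =>
              rw [hx] at hw
              have hsub : (univ.filter fun S' => reveal V S' = some S) ⊆ {S} := by
                intro S' hS'
                simp only [mem_filter, mem_univ, true_and, reveal_eq_some] at hS'
                exact mem_singleton.2 hS'.2
              refine (sum_le_sum_of_subset_of_nonneg hsub fun S' _ _ => ?_).trans ?_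
              · split_ifs; exacts [le_rfl, hω _]
              · rw [sum_singleton, weight]
  | succ r ih =>
    intro V hd hV x
    have hwnn : ∀ i, 0 ≤ weight ω q W t V (x i) := fun i =>
      weight_nonneg hq hω ht hd (by omega) (x i)
    by_cases hex : ∃ f : ι → Finset α, (∀ i, reveal V (f i) = x i) ∧ Survives pick W (r + 1) V f
    -- All `f` compatible with `x` have the same covered set, so any witness determines the vertex
    -- `v` removed next. Without a witness the left side is zero.
    · obtain ⟨f₀, hf₀, hs₀⟩ := hex
      have hv := hpick _ hs₀.2.1
      set v := pick (covered V f₀) with hvdef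
      have hvV := notMem_of_mem_covered hv
      have hvW : v ∉ W := by
        intro h
        obtain ⟨i, hi⟩ := mem_covered.1 hv
        exact hs₀.1 i v h hi
      have hd' : Disjoint (insert v V) W := by rw [disjoint_insert_left]; exact ⟨hvW, hd⟩
      have hcard : (insert v V).card = V.card + 1 := card_insert_of_notMem hvV
      have hprod : ∀ f : ι → Finset α, 0 ≤ ∏ i, ω (f i) := fun f => prod_nonneg fun i _ => hω _
      have hmaps : ∀ f ∈ (univ.filter fun f : ι → Finset α => ∀ i, reveal V (f i) = x i),
          (fun i => reveal (insert v V) (f i)) ∈ Fintype.piFinset fun i => refinements V v (x i) := by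
        intro f hf
        simp only [mem_filter, mem_univ, true_and] at hf
        rw [Fintype.mem_piFinset]
        intro i
        rw [← hf i]
        exact reveal_mem_refine V v (f i)
      calc _ ≤ ∑ f : ι → Finset α with (∀ i, reveal V (f i) = x i),
            (if Survives pick W r (insert v V) f then ∏ i, ω (f i) else 0) := by
            refine sum_le_sum fun f hf => ?_
            simp only [mem_filter, mem_univ, true_and] at hf
            have hcov : covered V f = covered V f₀ :=
              covered_congr fun i => (hf i).trans (hf₀ i).symm
            by_cases hs : Survives pick W (r + 1) V f
            · have hs' := hs.2.2
              rw [hcov, ← hvdef] at hs'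
              rw [if_pos hs, if_pos hs']
            · rw [if_neg hs]
              split_ifs; exacts [hprod f, le_rfl]
        -- Split according to what is known after the removal of `v`. The induction hypothesis
        -- bounds each fibre, and the sum of products factors again over the droplets.
        _ = ∑ y ∈ Fintype.piFinset fun i => refinements V v (x i),
              ∑ f ∈ (univ.filter fun f : ι → Finset α => ∀ i, reveal V (f i) = x i) with
                (fun i => reveal (insert v V) (f i)) = y,
              (if Survives pick W r (insert v V) f then ∏ i, ω (f i) else 0) :=
            (sum_fiberwise_of_maps_to hmaps _).symm
        _ ≤ ∑ y ∈ Fintype.piFinset fun i => refinements V v (x i),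
              ∏ i, weight ω q W t (insert v V) (y i) := by
            refine sum_le_sum fun y _ => ?_
            refine le_trans (sum_le_sum_of_subset_of_nonneg ?_ fun f _ _ => ?_)
              (ih (insert v V) hd' (by omega) y)
            · intro f hf
              simp only [mem_filter, mem_univ, true_and] at hf ⊢
              exact fun i => congrFun hf.2 i
            · split_ifs; exacts [hprod f, le_rfl]
        _ = ∏ i, ∑ y ∈ refinements V v (x i), weight ω q W t (insert v V) y :=
            (prod_univ_sum _ _).symm
        _ ≤ _ := by
            refine prod_le_prod (fun i _ => sum_nonneg fun y _ => ?_) fun i _ => ?_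
            · exact weight_nonneg hq hω ht hd' (by omega) y
            · exact sum_refine_le hq hω t hd hvV hvW (x i)
    · rw [sum_eq_zero]
      · exact prod_nonneg fun i _ => hwnn i
      · intro f hf
        simp only [mem_filter, mem_univ, true_and] at hf
        rw [if_neg fun hs => hex ⟨f, hf, hs⟩]

open Classical in
-- Before any removal, the weights of all possible states of knowledge of one droplet add up to `1 -
-- W.card * q t`, the probability of no hit for a fixed order.
lemma sum_survives_empty_le (pick : Finset α → α)
    (hpick : ∀ C : Finset α, C.Nonempty → pick C ∈ C)
    (hq : ∀ (V : Finset α) (w : α), w ∉ V → ∑ S with S \ V = {w}, ω S = q V.card)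
    (hω : ∀ S, 0 ≤ ω S) (hω1 : ∑ S, ω S = 1) {W : Finset α} {t : ℕ}
    (ht : t + W.card ≤ Fintype.card α) :
    ∑ f : ι → Finset α, (if Survives pick W t ∅ f then ∏ i, ω (f i) else 0) ≤
      (1 - W.card * q t) ^ Fintype.card ι := by
  set X : Finset (Option (Finset α)) :=
    insert none (({S | (S \ ∅).card ≤ 1} : Finset (Finset α)).image some) with hX
  have hnone : (none : Option (Finset α)) ∉
      (({S | (S \ ∅).card ≤ 1} : Finset (Finset α)).image some) := by simp
  have hmaps : ∀ f ∈ (univ : Finset (ι → Finset α)),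
      (fun i => reveal ∅ (f i)) ∈ Fintype.piFinset fun _ : ι => X := by
    intro f _
    rw [Fintype.mem_piFinset]
    intro i
    rw [hX, mem_insert, mem_image]
    by_cases h : (f i \ ∅).card ≤ 1
    · exact Or.inr ⟨f i, by simpa using h, (reveal_eq_some.2 ⟨h, rfl⟩).symm⟩
    · exact Or.inl (reveal_eq_none.2 (by omega))
  have hsum : ∑ x ∈ X, weight ω q W t ∅ x = 1 - W.card * q t := by
    rw [hX, sum_insert hnone, sum_image (by simp)]
    have e1 := sum_hit_eq hq (disjoint_empty_left W)
    simp only [weight]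
    simp only [sum_filter] at e1 ⊢
    have key : ∀ S : Finset α,
        (if 2 ≤ (S \ ∅).card then ω S else 0) +
          (if (S \ ∅).card ≤ 1 then (if ∃ w ∈ W, S \ ∅ = {w} then 0 else ω S) else 0) +
          (if ∃ w ∈ W, S \ ∅ = {w} then ω S else 0) = ω S := by
      intro S
      by_cases a : ∃ w ∈ W, S \ ∅ = {w}
      · have a1 : (S \ ∅).card = 1 := by
          obtain ⟨w, _, h⟩ := a
          rw [h, card_singleton]
        simp only [a, a1]; norm_num
      · by_cases h : (S \ ∅).card ≤ 1
        · have h' : ¬ 2 ≤ (S \ ∅).card := by omega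
          simp only [a, h, h']; norm_num
        · have h' : 2 ≤ (S \ ∅).card := by omega
          simp only [a, h, h']; norm_num
    have hs := sum_congr (rfl : (univ : Finset (Finset α)) = univ) fun S _ => key S
    simp only [sum_add_distrib] at hs
    rw [e1, hω1] at hs
    linarith
  calc _ = ∑ y ∈ Fintype.piFinset fun _ : ι => X,
        ∑ f ∈ (univ : Finset (ι → Finset α)) with (fun i => reveal ∅ (f i)) = y,
        (if Survives pick W t ∅ f then ∏ i, ω (f i) else 0) :=
        (sum_fiberwise_of_maps_to hmaps _).symm
    _ ≤ ∑ y ∈ Fintype.piFinset fun _ : ι => X, ∏ i, weight ω q W t ∅ (y i) := by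
        refine sum_le_sum fun y _ => ?_
        refine le_trans (le_of_eq ?_)
          (sum_survives_le pick hpick hq hω ht t ∅ (disjoint_empty_left W) (by simp) y)
        refine sum_congr ?_ fun _ _ => rfl
        ext f
        simp [funext_iff]
    _ = ∏ _i : ι, ∑ x ∈ X, weight ω q W t ∅ x := (prod_univ_sum _ _).symm
    _ = _ := by rw [hsum, prod_const, card_univ]

open Classical in
/-- A bound for the probability that independent random neighbour sets admit a nonempty stopping
set: a first moment over the `j u`-element subsets of a residual set of size `u`. -/
theorem sum_stopping_le [Nonempty α]
    (hq : ∀ (V : Finset α) (w : α), w ∉ V → ∑ S with S \ V = {w}, ω S = q V.card)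
    (hω : ∀ S, 0 ≤ ω S) (hω1 : ∑ S, ω S = 1) (j : ℕ → ℕ)
    (hj : ∀ u ∈ Icc 1 (Fintype.card α), j u ≤ u) :
    ∑ f : ι → Finset α with (∃ U : Finset α, U.Nonempty ∧ ∀ i, (f i ∩ U).card ≠ 1),
        ∏ i, ω (f i) ≤
      ∑ u ∈ Icc 1 (Fintype.card α), ((Fintype.card α).choose (j u) : ℝ) / (u.choose (j u)) *
        (1 - j u * q (Fintype.card α - u)) ^ Fintype.card ι := by
  obtain ⟨pick, hpick⟩ : ∃ pick : Finset α → α, ∀ C : Finset α, C.Nonempty → pick C ∈ C := by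
    exact ⟨fun C => if h : C.Nonempty then h.choose else Classical.arbitrary α, fun C hC => by
        simp only [hC, dif_pos]; exact hC.choose_spec⟩
  have hprod : ∀ f : ι → Finset α, 0 ≤ ∏ i, ω (f i) := fun f => prod_nonneg fun i _ => hω _
  -- If there is a stopping set, all `u.choose (j u)` subsets `W` of the residual set of size `u`
  -- survive. With weight `1 / u.choose (j u)` each, they account for the full product.
  have step : ∀ f : ι → Finset α,
      (if ∃ U : Finset α, U.Nonempty ∧ ∀ i, (f i ∩ U).card ≠ 1 then ∏ i, ω (f i) else 0) ≤
        ∑ u ∈ Icc 1 (Fintype.card α), ∑ W ∈ powersetCard (j u) (univ : Finset α),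
          (1 / (u.choose (j u)) : ℝ) *
            (if Survives pick W (Fintype.card α - u) ∅ f then ∏ i, ω (f i) else 0) := by
    intro f
    have hnn : ∀ u, ∀ W : Finset α, 0 ≤ (1 / (u.choose (j u)) : ℝ) *
        (if Survives pick W (Fintype.card α - u) ∅ f then ∏ i, ω (f i) else 0) := by
      intro u W
      refine mul_nonneg (by positivity) ?_
      split_ifs; exacts [hprod f, le_rfl]
    split_ifs with h
    · obtain ⟨U, hUne, hU⟩ := h
      obtain ⟨X, hUX, _, hX⟩ := exists_residual pick hpick hU _ ∅ le_rfl (disjoint_empty_left U)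
      have hu1 : X.card ∈ Icc 1 (Fintype.card α) := by
        rw [mem_Icc]
        exact ⟨card_pos.2 (hUne.mono hUX), card_le_univ X⟩
      refine le_trans ?_ (single_le_sum (f := fun u => ∑ W ∈ powersetCard (j u) (univ : Finset α),
          (1 / (u.choose (j u)) : ℝ) *
            (if Survives pick W (Fintype.card α - u) ∅ f then ∏ i, ω (f i) else 0))
        (fun u _ => sum_nonneg fun W _ => hnn u W) hu1)
      refine le_trans ?_ (sum_le_sum_of_subset_of_nonneg
        (powersetCard_mono (subset_univ X)) fun W _ _ => hnn _ W)
      have hc : (0 : ℝ) < X.card.choose (j X.card) := by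
        exact_mod_cast Nat.choose_pos (hj _ hu1)
      rw [sum_congr rfl (g := fun _ => (1 / (X.card.choose (j X.card)) : ℝ) * ∏ i, ω (f i))]
      · rw [sum_const, card_powersetCard, nsmul_eq_mul]
        refine le_of_eq ?_
        field_simp
      · intro W hW
        have := hX W (mem_powersetCard.1 hW).1
        simp only [card_empty, Nat.sub_zero] at this
        rw [if_pos this]
    · exact sum_nonneg fun u _ => sum_nonneg fun W _ => hnn u W
  rw [sum_filter]
  refine (sum_le_sum fun f _ => step f).trans ?_
  rw [sum_comm]
  refine sum_le_sum fun u hu => ?_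
  rw [sum_comm]
  have hu' := mem_Icc.1 hu
  calc _ ≤ ∑ W ∈ powersetCard (j u) (univ : Finset α), (1 / (u.choose (j u)) : ℝ) *
        (1 - j u * q (Fintype.card α - u)) ^ Fintype.card ι := by
        refine sum_le_sum fun W hW => ?_
        rw [← mul_sum]
        have hWc := (mem_powersetCard.1 hW).2
        have := hj u hu
        have h := sum_survives_empty_le (ι := ι) pick hpick hq hω hω1 (W := W)
          (t := Fintype.card α - u) (by omega)
        rw [hWc] at h
        exact mul_le_mul_of_nonneg_left h (by positivity)
    _ = _ := by
        rw [sum_const, card_powersetCard, nsmul_eq_mul, card_univ]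
        ring

end Weights

end Peeling

end SeF

namespace SeF

/-! ### The decoder in the presence of bad droplets -/

section Decoder

variable {h w q k : ℕ} {ι : Type*}

lemma block_add_self (v : Block h w q) : v + v = 0 := by
  ext <;> simp [CharTwo.add_self_eq_zero]

lemma encode_value_add_sum_erase (b : Fin k → Block h w q) {S : Finset (Fin k)} {m : Fin k}
    (hm : m ∈ S) : (encode b S).value + ∑ m' ∈ S.erase m, b m' = b m := by
  have : (encode b S).value = b m + ∑ m' ∈ S.erase m, b m' := (Finset.add_sum_erase S b hm).symm
  rw [this, add_assoc, block_add_self, add_zero]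

/-- The droplet `i` of the state `σ` is what the droplet `d` becomes when the blocks in `X` are
removed from it. -/
def IsReduced (b : Fin k → Block h w q) (X : Finset (Fin k)) (d : Droplet h w q k)
    (σ : PeelState h w q k ι) (i : ι) : Prop :=
  σ.nbrs i = d.nbrs \ X ∧ σ.value i = d.value + ∑ m ∈ d.nbrs ∩ X, b m

/-- The state `σ` can arise from the droplets `D` when the blocks decoded so far, those in `X`, are
decoded correctly and no droplet with index in `G` is deleted. -/
structure IsSound (b : Fin k → Block h w q) (D : ι → Option (Droplet h w q k)) (G : Set ι)
    (X : Finset (Fin k)) (σ : PeelState h w q k ι) : Prop where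
  decoded_eq : ∀ m, σ.decoded m = if m ∈ X then some (b m) else none
  nbrs_none : ∀ i, D i = none → σ.nbrs i = ∅
  reduced : ∀ i d, D i = some d → σ.nbrs i = ∅ ∨ IsReduced b X d σ i
  reduced_good : ∀ i ∈ G, ∀ d, D i = some d → IsReduced b X d σ i

lemma isSound_initState (b : Fin k → Block h w q) (D : ι → Option (Droplet h w q k)) (G : Set ι) :
    IsSound b D G ∅ (initState D) := by
  have hr : ∀ i d, D i = some d → IsReduced b ∅ d (initState D) i := by
    intro i d hd
    simp [IsReduced, initState, hd]
  exact ⟨fun m => by simp [initState], fun i hi => by simp [initState, hi],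
    fun i d hd => Or.inr (hr i d hd), fun i _ d hd => hr i d hd⟩

/-- The value of a singleton does not depend on the history of the decoder. This links the test in
the decoder to the static condition in `ExhibitsCollision`. -/
lemma IsReduced.value_eq {b : Fin k → Block h w q} {X : Finset (Fin k)} {d : Droplet h w q k}
    {σ : PeelState h w q k ι} {i : ι} (hr : IsReduced b X d σ i) {m : Fin k}
    (hs : σ.nbrs i = {m}) :
    m ∈ d.nbrs ∧ m ∉ X ∧ σ.value i = d.value + ∑ m' ∈ d.nbrs.erase m, b m' := by
  have hX : d.nbrs \ X = {m} := hr.1.symm.trans hs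
  have hm : m ∈ d.nbrs \ X := by rw [hX]; exact Finset.mem_singleton_self m
  rw [Finset.mem_sdiff] at hm
  refine ⟨hm.1, hm.2, ?_⟩
  rw [hr.2]
  congr 2
  have : d.nbrs.erase m = d.nbrs \ (d.nbrs \ X) := by rw [hX, Finset.sdiff_singleton_eq_erase]
  rw [this]
  ext x
  simp only [Finset.mem_inter, Finset.mem_sdiff]
  tauto

lemma IsReduced.accept {b : Fin k → Block h w q} {X : Finset (Fin k)} {d : Droplet h w q k}
    {σ : PeelState h w q k ι} {i' : ι} (hr : IsReduced b X d σ i') {i : ι} {m : Fin k}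
    (hmX : m ∉ X) (hv : σ.value i = b m) :
    IsReduced b (insert m X) d (σ.accept i m) i' := by
  refine ⟨?_, ?_⟩
  · simp only [PeelState.accept, hr.1]
    rw [Finset.sdiff_insert]
  · simp only [PeelState.accept, hr.1, hr.2, hv]
    by_cases hm : m ∈ d.nbrs
    · rw [if_pos (Finset.mem_sdiff.2 ⟨hm, hmX⟩), Finset.inter_insert_of_mem hm,
        Finset.sum_insert (fun h => hmX (Finset.mem_inter.1 h).2), add_assoc, add_comm (b m)]
    · rw [if_neg (fun h => hm (Finset.mem_sdiff.1 h).1), Finset.inter_insert_of_notMem hm]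

variable [Fintype ι] [DecidableEq ι]

/-- The decoder succeeds if all droplets that pass the test are correct, and the good droplets
admit no nonempty stopping set. -/
lemma recovers_of_isSound {hash : List (ZMod 2) → (Fin h → ZMod 2)}
    {txs : (Fin q → ZMod 2) ↪ List (List (ZMod 2))} {b : Fin k → Block h w q}
    {D : ι → Option (Droplet h w q k)} {G : Set ι} {S : ι → Finset (Fin k)}
    (hG : ∀ i ∈ G, D i = some (encode b (S i)))
    (hroot : ∀ m, Header.root (b m).1 = payloadRoot hash txs (b m).2)
    (hacc : ∀ i d m, D i = some d → m ∈ d.nbrs →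
      Matches hash txs (b m).1 (d.value + ∑ m' ∈ d.nbrs.erase m, b m') →
        d.value + ∑ m' ∈ d.nbrs.erase m, b m' = b m)
    (hcover : ∀ U : Finset (Fin k), U.Nonempty → ∃ i ∈ G, (S i ∩ U).card = 1) (n : ℕ) :
    ∀ (X : Finset (Fin k)) (σ : PeelState h w q k ι), ∑ i, (σ.nbrs i).card ≤ n →
      IsSound b D G X σ → Recovers hash txs (fun m => (b m).1) b σ := by
  -- The induction is on the number of edges, since accepting and rejecting both remove the edge of
  -- the selected singleton.
  induction n with
  | zero =>
    intro X σ hn hσ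
    refine .done σ fun m => ?_
    rw [hσ.decoded_eq, if_pos]
    by_contra hm
    obtain ⟨i, hi, hc⟩ := hcover Xᶜ ⟨m, by simpa using hm⟩
    have hr := (hσ.reduced_good i hi _ (hG i hi)).1
    rw [← Finset.sdiff_eq_inter_compl] at hc
    have h0 : (σ.nbrs i).card = 0 := by
      have := Finset.single_le_sum (f := fun i => (σ.nbrs i).card) (fun _ _ => Nat.zero_le _)
        (Finset.mem_univ i)
      omega
    rw [hr] at h0
    simp only [encode] at h0
    omega
  | succ n ih =>
    intro X σ hn hσ
    by_cases hX : X = Finset.univ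
    · exact .done σ fun m => by rw [hσ.decoded_eq, if_pos (by simp [hX])]
    have hXne : (Xᶜ).Nonempty := by
      rw [Finset.nonempty_iff_ne_empty, Ne, Finset.compl_eq_empty_iff]; exact hX
    refine .step σ ?_ ?_ ?_
    · obtain ⟨m, hm⟩ := hXne
      exact ⟨m, by rw [hσ.decoded_eq, if_neg (Finset.mem_compl.1 hm)]⟩
    -- The set of undecoded blocks is not a stopping set, and good droplets are never deleted, so
    -- one of them is a singleton now.
    · obtain ⟨i, hi, hc⟩ := hcover _ hXne
      have hr := (hσ.reduced_good i hi _ (hG i hi)).1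
      rw [← Finset.sdiff_eq_inter_compl, Finset.card_eq_one] at hc
      obtain ⟨m, hm⟩ := hc
      have hs : σ.nbrs i = {m} := hr.trans hm
      by_cases ht : Matches hash txs (b m).1 (σ.value i)
      · exact ⟨_, .accept i m hs ht⟩
      · exact ⟨_, .reject i m hs ht⟩
    · rintro σ' (⟨i, m, hs, hm⟩ | ⟨i, m, hs, hm⟩)
      · obtain ⟨d, hd⟩ : ∃ d, D i = some d := by
          cases hD : D i with
          | none => rw [hσ.nbrs_none i hD] at hs; simp at hs
          | some d => exact ⟨d, rfl⟩
        have hr : IsReduced b X d σ i :=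
          (hσ.reduced i d hd).resolve_left (by rw [hs]; simp)
        obtain ⟨hmd, hmX, hv⟩ := hr.value_eq hs
        have hvb : σ.value i = b m := by
          rw [hv]
          refine hacc i d m hd hmd ?_
          rw [← hv]; exact hm
        refine ih (insert m X) _ ?_ ⟨fun m' => ?_, fun i' hi' => ?_, fun i' d' hd' => ?_,
          fun i' hi' d' hd' => (hσ.reduced_good i' hi' d' hd').accept hmX hvb⟩
        · have hlt : ∑ i', ((σ.accept i m).nbrs i').card < ∑ i', (σ.nbrs i').card := by
            refine Finset.sum_lt_sum (fun i' _ => Finset.card_le_card (Finset.erase_subset _ _))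
              ⟨i, Finset.mem_univ i, ?_⟩
            simp [PeelState.accept, hs]
          omega
        · simp only [PeelState.accept, Function.update_apply, Finset.mem_insert, hσ.decoded_eq,
            hvb]
          by_cases hmm : m' = m
          · simp [hmm]
          · simp [hmm]
        · simp [PeelState.accept, hσ.nbrs_none i' hi']
        · rcases hσ.reduced i' d' hd' with h0 | h1
          · left; simp [PeelState.accept, h0]
          · right; exact h1.accept hmX hvb
      -- A good singleton carries the true block, which passes the test.
      · have hiG : i ∉ G := by
          intro hi
          have hr := hσ.reduced_good i hi _ (hG i hi)
          obtain ⟨hmd, _, hv⟩ := hr.value_eq hs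
          have hvb : σ.value i = b m := by
            rw [hv]; exact encode_value_add_sum_erase b hmd
          exact hm (by rw [hvb]; exact ⟨rfl, (hroot m).symm⟩)
        have hne : ∀ i', i' ≠ i → (σ.reject i).nbrs i' = σ.nbrs i' := fun i' h' => by
          simp [PeelState.reject, h']
        have hi0 : (σ.reject i).nbrs i = ∅ := by simp [PeelState.reject]
        refine ih X _ ?_ ⟨hσ.decoded_eq, fun i' hi' => ?_, fun i' d' hd' => ?_,
          fun i' hi' d' hd' => ?_⟩
        · have hlt : ∑ i', ((σ.reject i).nbrs i').card < ∑ i', (σ.nbrs i').card := by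
            refine Finset.sum_lt_sum (fun i' _ => ?_) ⟨i, Finset.mem_univ i, ?_⟩
            · by_cases h' : i' = i
              · rw [h', hi0]; simp
              · rw [hne i' h']
            · rw [hi0, hs]; simp
          omega
        · by_cases h' : i' = i
          · rw [h', hi0]
          · rw [hne i' h', hσ.nbrs_none i' hi']
        · by_cases h' : i' = i
          · left; rw [h', hi0]
          · rcases hσ.reduced i' d' hd' with h0 | h1
            · left; rw [hne i' h', h0]
            · right; exact ⟨(hne i' h').trans h1.1, h1.2⟩
        · have h' : i' ≠ i := by rintro rfl; exact hiG hi'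
          have h1 := hσ.reduced_good i' hi' d' hd'
          exact ⟨(hne i' h').trans h1.1, h1.2⟩

/-- Without a Merkle collision, the blockchain is recovered if the honest droplets admit no
nonempty stopping set. -/
theorem recoversChain_of_not_collision {s : ℕ} {J : Type*} [Fintype J] [DecidableEq J]
    {hash : List (ZMod 2) → (Fin h → ZMod 2)} {txs : (Fin q → ZMod 2) ↪ List (List (ZMod 2))}
    {e : ℕ} {B : ℕ → Block h w q} (hB : IsBlockchain hash txs (e * k) B) {T A : Finset J}
    {V : J × Fin s → Finset (Fin k)} {adv : Fin e → J × Fin s → Option (Droplet h w q k)}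
    (hcol : ¬ ExhibitsCollision hash txs e B T A adv)
    (hcover : ∀ U : Finset (Fin k), U.Nonempty →
      ∃ i : J × Fin s, i.1 ∈ T \ A ∧ (V i ∩ U).card = 1) :
    RecoversChain hash txs e B T A V adv := by
  intro l
  have hroot : ∀ m, Header.root (epochBlock B k l m).1 =
      payloadRoot hash txs (epochBlock B k l m).2 := by
    intro m
    refine hB.root_eq _ ?_
    calc (l : ℕ) * k + m < l * k + k := by have := m.2; omega
      _ = (l + 1) * k := by ring
      _ ≤ e * k := Nat.mul_le_mul_right k l.2
  refine recovers_of_isSound (G := {i | i.1 ∈ T \ A}) (S := V) ?_ hroot ?_ ?_ _ ∅ _ le_rfl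
    (isSound_initState _ _ _)
  · rintro i hi
    rw [Set.mem_ofPred_eq, Finset.mem_sdiff] at hi
    simp [download, hi.1, hi.2]
  · intro i d m hd hmd hmt
    by_cases hT : i.1 ∈ T
    · by_cases hA : i.1 ∈ A
      · simp only [download, hT, hA, if_true] at hd
        -- The test forces the true header, so a wrong value has a wrong payload with the Merkle
        -- root of the true one.
        by_contra hne
        refine hcol ⟨l, i, d, m, hT, hA, hd, hmd, fun h2 => hne (Prod.ext hmt.1 h2), ?_⟩
        exact hmt.2.trans (hroot m)
      · simp only [download, hT, hA, if_true, if_false, Option.some.injEq] at hd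
        subst hd
        exact encode_value_add_sum_erase _ hmd
    · simp [download, hT] at hd
  · intro U hU
    obtain ⟨i, hi, hc⟩ := hcover U hU
    exact ⟨i, hi, hc⟩

end Decoder

end SeF

namespace SeF

/-! ### The law of the neighbour sets -/

lemma sum_Icc_one_eq {M : Type*} [AddCommMonoid M] (F : ℕ → M) (k : ℕ) :
    ∑ d ∈ Finset.Icc 1 k, F d = ∑ e ∈ Finset.range k, F (e + 1) := by
  rw [Finset.range_eq_Ico, Finset.sum_Ico_add' F 0 k 1]
  exact Finset.sum_congr (by ext x; simp only [Finset.mem_Icc, Finset.mem_Ico]; omega) fun _ _ => rfl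

section Law

variable {k : ℕ} {c δ : ℝ}

lemma uniformOn_card_singleton (d : ℕ) (S : Finset (Fin k)) :
    uniformOn {S : Finset (Fin k) | S.card = d} {S} =
      if S.card = d then ((k.choose d : ℕ) : ENNReal)⁻¹ else 0 := by
  have hset : {S : Finset (Fin k) | S.card = d} =
      ((Finset.powersetCard d (Finset.univ : Finset (Fin k)) :
        Finset (Finset (Fin k))) : Set (Finset (Fin k))) := by
    ext S; simp
  rw [uniformOn, cond_apply (Set.toFinite _).measurableSet]
  split_ifs with h
  · rw [Set.inter_eq_right.2 (by simpa using h), Measure.count_singleton, mul_one, hset,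
      Measure.count_apply_finset, Finset.card_powersetCard, Finset.card_univ, Fintype.card_fin]
  · rw [Set.inter_singleton_eq_empty.2 (by simpa using h)]
    simp

/-- The probability of a set of `d` neighbours. -/
noncomputable def pointMass (k : ℕ) (c δ : ℝ) (d : ℕ) : ℝ :=
  -- The `max` mirrors the truncation by `ENNReal.ofReal` in `neighborLaw`, so that no sign of
  -- `theta` is needed here.
  max (robustSoliton k c δ d) 0 / k.choose d

/-- The probability that, of a given set of `k - t` blocks, a given one is the only neighbour. -/
noncomputable def hitProb (k : ℕ) (c δ : ℝ) (t : ℕ) : ℝ :=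
  ∑ d ∈ Finset.Icc 1 k, max (robustSoliton k c δ d) 0 * (t.choose (d - 1) / k.choose d)

lemma neighborLaw_singleton (S : Finset (Fin k)) :
    neighborLaw k c δ {S} =
      if S = ∅ then 0 else ENNReal.ofReal (pointMass k c δ S.card) := by
  have hle : S.card ≤ k := by simpa using Finset.card_le_univ S
  rw [neighborLaw, Measure.finsetSum_apply]
  simp only [Measure.smul_apply, uniformOn_card_singleton, smul_eq_mul, mul_ite, mul_zero]
  rw [Finset.sum_ite_eq]
  by_cases h : S = ∅
  · simp [h]
  · have h1 : 1 ≤ S.card := Finset.card_pos.2 (Finset.nonempty_iff_ne_empty.2 h)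
    rw [if_pos (Finset.mem_Icc.2 ⟨h1, hle⟩), if_neg h, pointMass,
      ENNReal.ofReal_div_of_pos (by exact_mod_cast Nat.choose_pos hle), div_eq_mul_inv,
      ENNReal.ofReal_natCast]
    congr 1
    rcases le_total (robustSoliton k c δ S.card) 0 with h0 | h0
    · rw [max_eq_right h0, ENNReal.ofReal_of_nonpos h0, ENNReal.ofReal_zero]
    · rw [max_eq_left h0]

lemma neighborLaw_real_singleton (S : Finset (Fin k)) :
    (neighborLaw k c δ).real {S} = if S = ∅ then 0 else pointMass k c δ S.card := by
  rw [Measure.real, neighborLaw_singleton]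
  split_ifs
  · simp
  · rw [ENNReal.toReal_ofReal]
    unfold pointMass
    positivity

/-- These `S` are `w` together with an arbitrary subset of `V`, and the law sees only cardinalities.
It is the hypothesis `hq` of the peeling bounds. -/
lemma sum_neighborLaw_sdiff_eq (V : Finset (Fin k)) (w : Fin k) (hw : w ∉ V) :
    ∑ S with S \ V = {w}, (neighborLaw k c δ).real {S} = hitProb k c δ V.card := by
  have hlt : V.card < k := by
    have h := Finset.card_le_univ (insert w V)
    rw [Finset.card_insert_of_notMem hw, Fintype.card_fin] at h
    omega
  have e1 : ∑ S with S \ V = {w}, (neighborLaw k c δ).real {S} =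
      ∑ S ∈ V.powerset, pointMass k c δ (S.card + 1) := by
    symm
    refine Finset.sum_bij' (fun S _ => insert w S) (fun S _ => S.erase w) ?_ ?_ ?_ ?_ ?_
    · intro S hS
      rw [Finset.mem_powerset] at hS
      simp only [Finset.mem_filter, Finset.mem_univ, true_and]
      rw [Finset.insert_sdiff_of_notMem _ hw, Finset.sdiff_eq_empty_iff_subset.2 hS]
      rfl
    · intro S hS
      simp only [Finset.mem_filter, Finset.mem_univ, true_and] at hS
      rw [Finset.mem_powerset]
      intro x hx
      rw [Finset.mem_erase] at hx
      by_contra hxV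
      have : x ∈ S \ V := Finset.mem_sdiff.2 ⟨hx.2, hxV⟩
      rw [hS, Finset.mem_singleton] at this
      exact hx.1 this
    · intro S hS
      rw [Finset.mem_powerset] at hS
      exact Finset.erase_insert fun h => hw (hS h)
    · intro S hS
      simp only [Finset.mem_filter, Finset.mem_univ, true_and] at hS
      refine Finset.insert_erase ?_
      have : w ∈ S \ V := by rw [hS]; exact Finset.mem_singleton_self w
      exact (Finset.mem_sdiff.1 this).1
    · intro S hS
      rw [Finset.mem_powerset] at hS
      rw [neighborLaw_real_singleton, if_neg (Finset.insert_ne_empty _ _),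
        Finset.card_insert_of_notMem fun h => hw (hS h)]
  rw [e1, Finset.sum_powerset_apply_card (fun i => pointMass k c δ (i + 1)), hitProb]
  rw [sum_Icc_one_eq]
  refine Finset.sum_subset_zero_on_sdiff (fun x hx => ?_) (fun x hx => ?_) fun x hx => ?_
  · rw [Finset.mem_range] at hx ⊢; omega
  · simp only [Finset.mem_sdiff, Finset.mem_range, not_lt] at hx
    simp [Nat.choose_eq_zero_of_lt (show V.card < x by omega)]
  · simp only [Nat.add_sub_cancel, pointMass, nsmul_eq_mul]
    ring

end Law

/-! ### Stopping sets of random droplets -/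

section Probability

variable {Ω : Type*} [MeasurableSpace Ω] {P : Measure Ω} {k : ℕ} {c δ : ℝ}

lemma HasLaw.measure_eq {V : Ω → Finset (Fin k)} (hV : HasLaw V (neighborLaw k c δ) P)
    (S : Finset (Fin k)) : P (V ⁻¹' {S}) = neighborLaw k c δ {S} := by
  rw [← hV.map_eq, Measure.map_apply_of_aemeasurable hV.aemeasurable
    (measurableSet_singleton S)]

lemma sum_neighborLaw_real [IsProbabilityMeasure (neighborLaw k c δ)] :
    ∑ S : Finset (Fin k), (neighborLaw k c δ).real {S} = 1 := by
  simp

/-- The neighbour sets `V i`, `i ∈ I`, admit a nonempty stopping set. -/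
def HasStoppingSet {ι : Type*} (V : ι → Finset (Fin k)) (I : Finset ι) : Prop :=
  ∃ U : Finset (Fin k), U.Nonempty ∧ ∀ i ∈ I, (V i ∩ U).card ≠ 1

theorem prob_hasStoppingSet_le [IsProbabilityMeasure P] {ι : Type*} [DecidableEq ι]
    {V : ι → Ω → Finset (Fin k)} (hk : 1 ≤ k) (hV : ∀ i, HasLaw (V i) (neighborLaw k c δ) P)
    (hind : iIndepFun V P) (I : Finset ι) (hI : I.Nonempty) (j : ℕ → ℕ)
    (hj : ∀ u ∈ Finset.Icc 1 k, j u ≤ u) :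
    P {ω | HasStoppingSet (fun i => V i ω) I} ≤
      ENNReal.ofReal (∑ u ∈ Finset.Icc 1 k, (k.choose (j u) : ℝ) / (u.choose (j u)) *
        (1 - j u * hitProb k c δ (k - u)) ^ I.card) := by
  classical
  obtain ⟨i₀, _⟩ := hI
  have : IsProbabilityMeasure (neighborLaw k c δ) := by
    rw [← (hV i₀).map_eq]
    exact Measure.isProbabilityMeasure_map (hV i₀).aemeasurable
  have : Nonempty (Fin k) := ⟨⟨0, hk⟩⟩
  set bad : Finset (I → Finset (Fin k)) := Finset.univ.filter fun f =>
    ∃ U : Finset (Fin k), U.Nonempty ∧ ∀ i, (f i ∩ U).card ≠ 1 with hbad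
  have hsub : {ω | HasStoppingSet (fun i => V i ω) I} ⊆
      ⋃ f ∈ bad, ⋂ i ∈ (Finset.univ : Finset I), V i ⁻¹' {f i} := by
    rintro ω ⟨U, hU, h⟩
    simp only [Set.mem_iUnion]
    refine ⟨fun i => V i ω, ?_, by simp⟩
    rw [hbad, Finset.mem_filter]
    exact ⟨Finset.mem_univ _, U, hU, fun i => h i i.2⟩
  have hind' : iIndepFun (fun i : I => V i) P := hind.precomp Subtype.val_injective
  have key := sum_stopping_le (α := Fin k) (ι := I) (q := hitProb k c δ)
    (ω := fun S => (neighborLaw k c δ).real {S}) sum_neighborLaw_sdiff_eq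
    (fun S => measureReal_nonneg) sum_neighborLaw_real j (by simpa using hj)
  simp only [Fintype.card_fin, Fintype.card_coe] at key
  calc P {ω | HasStoppingSet (fun i => V i ω) I}
      ≤ P (⋃ f ∈ bad, ⋂ i ∈ (Finset.univ : Finset I), V i ⁻¹' {f i}) := measure_mono hsub
    _ ≤ ∑ f ∈ bad, P (⋂ i ∈ (Finset.univ : Finset I), V i ⁻¹' {f i}) :=
        measure_biUnion_finset_le _ _
    _ = ∑ f ∈ bad, ENNReal.ofReal (∏ i, (neighborLaw k c δ).real {f i}) := by
        refine Finset.sum_congr rfl fun f _ => ?_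
        rw [hind'.measure_inter_preimage_eq_mul _ fun i _ => measurableSet_singleton (f i),
          ENNReal.ofReal_prod_of_nonneg fun i _ => measureReal_nonneg]
        refine Finset.prod_congr rfl fun i _ => ?_
        rw [HasLaw.measure_eq (hV i), ofReal_measureReal]
    _ = ENNReal.ofReal (∑ f ∈ bad, ∏ i, (neighborLaw k c δ).real {f i}) :=
        (ENNReal.ofReal_sum_of_nonneg fun f _ =>
          Finset.prod_nonneg fun i _ => measureReal_nonneg).symm
    _ ≤ _ := by
        exact ENNReal.ofReal_le_ofReal key

/-- The left side is the probability of a union of `j` disjoint events. It makes the base `1 - j q`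
nonnegative, so that its powers can be compared with exponentials. -/
lemma mul_hitProb_le_one [IsProbabilityMeasure (neighborLaw k c δ)] {j u : ℕ} (hju : j ≤ u)
    (hu : u ≤ k) : j * hitProb k c δ (k - u) ≤ 1 := by
  obtain ⟨V, -, hV⟩ := Finset.exists_subset_card_eq (s := (Finset.univ : Finset (Fin k)))
    (n := k - u) (by simp)
  obtain ⟨W, hWV, hW⟩ := Finset.exists_subset_card_eq (s := Vᶜ) (n := j)
    (by rw [Finset.card_compl, Fintype.card_fin]; omega)
  have h := sum_hit_eq (ω := fun S => (neighborLaw k c δ).real {S}) (W := W)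
    sum_neighborLaw_sdiff_eq (Finset.disjoint_left.2 fun x hx hxW =>
      Finset.mem_compl.1 (hWV hxW) hx : Disjoint V W)
  rw [hV, hW] at h
  rw [← h, ← sum_neighborLaw_real (k := k) (c := c) (δ := δ)]
  exact Finset.sum_le_sum_of_subset_of_nonneg (Finset.subset_univ _)
    fun _ _ _ => measureReal_nonneg

theorem prob_hasStoppingSet_le_exp [IsProbabilityMeasure P] {ι : Type*} [DecidableEq ι]
    {V : ι → Ω → Finset (Fin k)} (hk : 1 ≤ k) (hV : ∀ i, HasLaw (V i) (neighborLaw k c δ) P)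
    (hind : iIndepFun V P) (I : Finset ι) (hI : I.Nonempty) (j : ℕ → ℕ)
    (hj : ∀ u ∈ Finset.Icc 1 k, j u ≤ u) :
    P {ω | HasStoppingSet (fun i => V i ω) I} ≤
      ENNReal.ofReal (∑ u ∈ Finset.Icc 1 k, (k.choose (j u) : ℝ) / (u.choose (j u)) *
        Real.exp (-(j u * (I.card * hitProb k c δ (k - u))))) := by
  refine (prob_hasStoppingSet_le hk hV hind I hI j hj).trans (ENNReal.ofReal_le_ofReal ?_)
  obtain ⟨i₀, _⟩ := hI
  have : IsProbabilityMeasure (neighborLaw k c δ) := by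
    rw [← (hV i₀).map_eq]
    exact Measure.isProbabilityMeasure_map (hV i₀).aemeasurable
  refine Finset.sum_le_sum fun u hu => mul_le_mul_of_nonneg_left ?_ (by positivity)
  have h1 := mul_hitProb_le_one (c := c) (δ := δ) (hj u hu) (Finset.mem_Icc.1 hu).2
  calc (1 - j u * hitProb k c δ (k - u)) ^ I.card
      ≤ Real.exp (-(j u * hitProb k c δ (k - u))) ^ I.card := by
        refine pow_le_pow_left₀ (by linarith) ?_ _
        have := Real.add_one_le_exp (-(j u * hitProb k c δ (k - u)))
        linarith
    _ = _ := by
        rw [← Real.exp_nat_mul]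
        congr 1
        ring

/-- If there is only one block, every droplet is a copy of it. -/
lemma prob_hasStoppingSet_one [IsProbabilityMeasure P] {ι : Type*}
    {V : ι → Ω → Finset (Fin 1)} (hV : ∀ i, HasLaw (V i) (neighborLaw 1 c δ) P)
    (I : Finset ι) (hI : I.Nonempty) : P {ω | HasStoppingSet (fun i => V i ω) I} = 0 := by
  obtain ⟨i, hi⟩ := hI
  refine measure_mono_null (t := V i ⁻¹' {∅}) ?_ ?_
  · rintro ω ⟨U, hU, h⟩
    by_contra hne
    have hU1 : U = Finset.univ := by
      obtain ⟨x, hx⟩ := hU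
      exact Finset.eq_univ_of_forall fun y => by rwa [Subsingleton.elim y x]
    have hV1 : V i ω = Finset.univ := by
      obtain ⟨x, hx⟩ := Finset.nonempty_iff_ne_empty.2 hne
      exact Finset.eq_univ_of_forall fun y => by rwa [Subsingleton.elim y x]
    exact h i hi (by simp [hU1, hV1])
  · rw [HasLaw.measure_eq (hV i), neighborLaw_singleton, if_pos rfl]

/-- A bound for every fixed set of droplets carries over to an oblivious adversary. -/
theorem prob_not_recoversChain_le [IsProbabilityMeasure P] {s h w q e : ℕ}
    {hash : List (ZMod 2) → (Fin h → ZMod 2)}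
    {txs : (Fin q → ZMod 2) ↪ List (List (ZMod 2))} {B : ℕ → Block h w q}
    (hB : IsBlockchain hash txs (e * k) B) {J : Type*} [Fintype J] [DecidableEq J]
    {V : J × Fin s → Ω → Finset (Fin k)} {T A : Ω → Finset J} (hT : Measurable T)
    (hA : Measurable A) (hind : IndepFun (fun ω => (T ω, A ω)) (fun ω i => V i ω) P)
    {N p : ℝ} (hs : 1 ≤ s) (hN : ∀ᵐ ω ∂P, (1 / s : ℝ) * N ≤ ((T ω \ A ω).card : ℝ))
    (hp : ∀ I : Finset (J × Fin s), N ≤ I.card →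
      P {ω | HasStoppingSet (fun i => V i ω) I} ≤ ENNReal.ofReal p)
    (adv : Ω → Fin e → J × Fin s → Option (Droplet h w q k)) :
    P {ω | ¬ RecoversChain hash txs e B (T ω) (A ω) (fun i => V i ω) (adv ω)} ≤
      ENNReal.ofReal p + P {ω | ExhibitsCollision hash txs e B (T ω) (A ω) (adv ω)} := by
  classical
  set good : Finset J × Finset J → Finset (J × Fin s) := fun x => (x.1 \ x.2) ×ˢ Finset.univ
    with hgood
  set bad : Set Ω := {ω | HasStoppingSet (fun i => V i ω) (good (T ω, A ω))} with hbad
  have hsub : {ω | ¬ RecoversChain hash txs e B (T ω) (A ω) (fun i => V i ω) (adv ω)} ⊆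
      bad ∪ {ω | ExhibitsCollision hash txs e B (T ω) (A ω) (adv ω)} := by
    intro ω hω
    by_contra hnot
    rw [Set.mem_union, not_or] at hnot
    refine hω (recoversChain_of_not_collision hB hnot.2 fun U hU => ?_)
    by_contra hall
    refine hnot.1 ⟨U, hU, fun i hi hc => hall ⟨i, ?_, hc⟩⟩
    simpa [hgood] using hi
  -- Only monotonicity and subadditivity are used, so `adv` may be an arbitrary function of `ω`.
  refine (measure_mono hsub).trans ((measure_union_le _ _).trans (add_le_add ?_ le_rfl))
  have hTA : Measurable fun ω => (T ω, A ω) := hT.prodMk hA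
  -- The pair `(T, A)` takes finitely many values; for each one, independence separates it from the
  -- neighbour sets.
  have hsplit : bad ⊆ ⋃ x ∈ (Finset.univ : Finset (Finset J × Finset J)),
      (fun ω => (T ω, A ω)) ⁻¹' {x} ∩
        (fun ω i => V i ω) ⁻¹' {v | HasStoppingSet v (good x)} := by
    intro ω hω
    simp only [Set.mem_iUnion]
    exact ⟨(T ω, A ω), Finset.mem_univ _, rfl, hω⟩
  have hterm : ∀ x : Finset J × Finset J,
      P ((fun ω => (T ω, A ω)) ⁻¹' {x} ∩
        (fun ω i => V i ω) ⁻¹' {v | HasStoppingSet v (good x)}) ≤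
      P ((fun ω => (T ω, A ω)) ⁻¹' {x}) * ENNReal.ofReal p := by
    intro x
    rw [hind.measure_inter_preimage_eq_mul _ _ (Set.toFinite _).measurableSet
      (Set.toFinite _).measurableSet]
    by_cases hx : (1 / s : ℝ) * N ≤ ((x.1 \ x.2).card : ℝ)
    · refine mul_le_mul le_rfl (hp (good x) ?_) zero_le zero_le
      have hs' : (0 : ℝ) < s := by exact_mod_cast hs
      rw [one_div, inv_mul_le_iff₀ hs'] at hx
      simp only [hgood, Finset.card_product, Finset.card_univ, Fintype.card_fin]
      push_cast
      linarith
    · have h0 : P ((fun ω => (T ω, A ω)) ⁻¹' {x}) = 0 := by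
        refine measure_mono_null (fun ω hω => ?_) hN
        rw [Set.mem_preimage, Set.mem_singleton_iff] at hω
        subst hω
        exact hx
      rw [h0, zero_mul, zero_mul]
  calc P bad ≤ ∑ x : Finset J × Finset J, P ((fun ω => (T ω, A ω)) ⁻¹' {x} ∩
        (fun ω i => V i ω) ⁻¹' {v | HasStoppingSet v (good x)}) :=
        (measure_mono hsplit).trans (measure_biUnion_finset_le _ _)
    _ ≤ ∑ x : Finset J × Finset J, P ((fun ω => (T ω, A ω)) ⁻¹' {x}) * ENNReal.ofReal p :=
        Finset.sum_le_sum fun x _ => hterm x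
    _ = ENNReal.ofReal p := by
        rw [← Finset.sum_mul, sum_measure_preimage_singleton _ fun x _ => hTA (measurableSet_singleton x)]
        simp

end Probability

end SeF

namespace SeF

/-! ### Binomial estimates -/

section Binomial

/-- A union bound: a random `e`-subset of `K` points contains each of `v` given points with
probability `e / K`. -/
lemma choose_mul_one_sub_le (K e : ℕ) (hK : 1 ≤ K) (v : ℕ) (hv : v ≤ K) :
    (K.choose e : ℝ) * (1 - v * e / K) ≤ (K - v).choose e := by
  have hK' : (0 : ℝ) < K := by exact_mod_cast hK
  induction v with
  | zero => simp
  | succ v ih =>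
    have ih := ih (by omega)
    rcases e with _ | e
    · simp
    · have h1 : ((K - v).choose (e + 1) : ℝ) =
          (K - (v + 1)).choose e + (K - (v + 1)).choose (e + 1) := by
        have : K - v = (K - (v + 1)) + 1 := by omega
        rw [this, Nat.choose_succ_succ]
        push_cast
        simp
      have h2 : ((K - (v + 1)).choose e : ℝ) ≤ (K - 1).choose e := by
        exact_mod_cast Nat.choose_le_choose e (by omega)
      have h3 : (K : ℝ) * (K - 1).choose e = K.choose (e + 1) * (e + 1) := by
        have h := Nat.add_one_mul_choose_eq (K - 1) e
        rw [Nat.sub_add_cancel hK] at h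
        exact_mod_cast h
      have h4 : ((K - 1).choose e : ℝ) = K.choose (e + 1) * (e + 1) / K := by
        rw [← h3]; field_simp
      rw [h4] at h2
      rw [h1] at ih
      push_cast at ih ⊢
      have h5 : (K.choose (e + 1) : ℝ) * (1 - (v + 1) * (e + 1) / K) =
          K.choose (e + 1) * (1 - v * (e + 1) / K) - K.choose (e + 1) * (e + 1) / K := by
        ring
      linarith

/-- Absorption, `(t + 1).choose (i + 1) / (N + 1).choose (i + 1) = (t + 1) / (N + 1) * (t.choose i /
N.choose i)`, reduces `t + 1` to `t` with `N` lowered as well. -/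
lemma sum_choose_div_choose (t : ℕ) : ∀ N : ℕ, t ≤ N →
    ∑ i ∈ Finset.range (t + 1), (t.choose i : ℝ) / N.choose i = (N + 1) / (N + 1 - t) := by
  induction t with
  | zero =>
    intro N _
    have : (N : ℝ) + 1 ≠ 0 := by positivity
    simp [this]
  | succ t ih =>
    intro N hN
    obtain ⟨N, rfl⟩ : ∃ M, N = M + 1 := ⟨N - 1, by omega⟩
    have hN' : t ≤ N := by omega
    rw [Finset.sum_range_succ']
    have e1 : ∀ i ∈ Finset.range (t + 1), ((t + 1).choose (i + 1) : ℝ) / (N + 1).choose (i + 1) =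
        ((t + 1) / (N + 1)) * (t.choose i / N.choose i) := by
      intro i hi
      rw [Finset.mem_range] at hi
      have h1 : ((t : ℝ) + 1) * t.choose i = (t + 1).choose (i + 1) * (i + 1) := by
        exact_mod_cast Nat.add_one_mul_choose_eq t i
      have h2 : ((N : ℝ) + 1) * N.choose i = (N + 1).choose (i + 1) * (i + 1) := by
        exact_mod_cast Nat.add_one_mul_choose_eq N i
      have p1 : (0 : ℝ) < N.choose i := by exact_mod_cast Nat.choose_pos (by omega)
      have p2 : (0 : ℝ) < (N + 1).choose (i + 1) := by exact_mod_cast Nat.choose_pos (by omega)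
      have p3 : (0 : ℝ) < i + 1 := by positivity
      have p4 : (0 : ℝ) < N + 1 := by positivity
      rw [div_mul_div_comm, h1, h2]
      field_simp
    rw [Finset.sum_congr rfl e1, ← Finset.mul_sum, ih N hN']
    have p : (0 : ℝ) < N + 1 - t := by
      have : (t : ℝ) ≤ N := by exact_mod_cast hN'
      linarith
    have p4 : (0 : ℝ) < N + 1 := by positivity
    push_cast
    have p5 : (N : ℝ) + 1 + 1 - (t + 1) = N + 1 - t := by ring
    rw [p5]
    simp only [Nat.choose_zero_right, Nat.cast_one, div_one]
    field_simp
    ring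

/-- The quotient is a product of factors `(k - i) / (u - i)`, each at most `k / u * (1 + 2 * i / u)`
because `2 * i ≤ u`. The excess `2 * i / u` sums to less than `j ^ 2 / u`. -/
lemma choose_div_choose_le_exp {k u : ℕ} (hu : 1 ≤ u) (huk : u ≤ k) (j : ℕ) (hj : 2 * j ≤ u) :
    (k.choose j : ℝ) / u.choose j ≤ Real.exp (j * Real.log (k / u) + j ^ 2 / u) := by
  have hu' : (0 : ℝ) < u := by exact_mod_cast hu
  have hk' : (0 : ℝ) < k := by exact_mod_cast (by omega : 0 < k)
  induction j with
  | zero => simp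
  | succ j ih =>
    have ih := ih (by omega)
    have hju : ((j : ℝ) + 1) * 2 ≤ u := by
      have : (((j + 1) * 2 : ℕ) : ℝ) ≤ u := by exact_mod_cast (by omega : (j + 1) * 2 ≤ u)
      push_cast at this; linarith
    have hj0 : (0 : ℝ) ≤ j := by positivity
    have hujpos : (0 : ℝ) < u - j := by linarith
    have h1 : (k.choose (j + 1) : ℝ) * (j + 1) = k.choose j * (k - j) := by
      have h := Nat.choose_succ_right_eq k j
      have h' : (k.choose (j + 1) : ℝ) * (j + 1) = k.choose j * ((k - j : ℕ) : ℝ) := by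
        exact_mod_cast h
      rwa [Nat.cast_sub (by omega)] at h'
    have h2 : (u.choose (j + 1) : ℝ) * (j + 1) = u.choose j * (u - j) := by
      have h := Nat.choose_succ_right_eq u j
      have h' : (u.choose (j + 1) : ℝ) * (j + 1) = u.choose j * ((u - j : ℕ) : ℝ) := by
        exact_mod_cast h
      rwa [Nat.cast_sub (by omega)] at h'
    have p1 : (0 : ℝ) < u.choose j := by exact_mod_cast Nat.choose_pos (by omega)
    have p2 : (0 : ℝ) < u.choose (j + 1) := by exact_mod_cast Nat.choose_pos (by omega)
    have p3 : (0 : ℝ) < (j : ℝ) + 1 := by positivity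
    have e1 : (k.choose (j + 1) : ℝ) / u.choose (j + 1) =
        (k.choose j / u.choose j) * ((k - j) / (u - j)) := by
      rw [div_mul_div_comm, ← h1, ← h2]
      field_simp
    have e2 : ((k : ℝ) - j) / (u - j) ≤ Real.exp (Real.log (k / u) + 2 * j / u) := by
      rw [Real.exp_add, Real.exp_log (by positivity)]
      have h3 : 1 + 2 * j / u ≤ Real.exp (2 * j / (u : ℝ)) := by
        have := Real.add_one_le_exp (2 * j / (u : ℝ)); linarith
      have h4 : ((k : ℝ) - j) / (u - j) ≤ k / u * (1 + 2 * j / u) := by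
        rw [div_le_iff₀ hujpos]
        have h5 : k / u * (1 + 2 * j / u) * ((u : ℝ) - j) = k + k * j * (u - 2 * j) / u ^ 2 := by
          field_simp
          ring
        rw [h5]
        have h6 : 0 ≤ (k : ℝ) * j * (u - 2 * j) / u ^ 2 := by
          apply div_nonneg _ (by positivity)
          apply mul_nonneg (by positivity)
          linarith
        linarith
      exact h4.trans (mul_le_mul_of_nonneg_left h3 (by positivity))
    have e3 : (0 : ℝ) ≤ (k - j) / (u - j) := by
      apply div_nonneg _ hujpos.le
      have : (u : ℝ) ≤ k := by exact_mod_cast huk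
      linarith
    rw [e1]
    refine (mul_le_mul ih e2 e3 (Real.exp_pos _).le).trans ?_
    rw [← Real.exp_add, Real.exp_le_exp]
    push_cast
    have : (j : ℝ) * Real.log (k / u) + j ^ 2 / u + (Real.log (k / u) + 2 * j / u) =
      (j + 1) * Real.log (k / u) + ((j + 1) ^ 2 / u - 1 / u) := by
      field_simp
      ring
    rw [this]
    have : 0 ≤ 1 / (u : ℝ) := by positivity
    linarith

lemma choose_le_exp_mul_log {k u : ℕ} (hu : 1 ≤ u) (huk : u ≤ k) :
    (k.choose u : ℝ) ≤ Real.exp (u * Real.log (k / u) + u) := by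
  have hu' : (0 : ℝ) < u := by exact_mod_cast hu
  have hk' : (0 : ℝ) < k := by exact_mod_cast (by omega : 0 < k)
  have h1 : (k.choose u : ℝ) ≤ k ^ u / (u.factorial : ℝ) := Nat.choose_le_pow_div u k
  have h2 : (u : ℝ) ^ u / u.factorial ≤ Real.exp u := Real.pow_div_factorial_le_exp _ hu'.le u
  rw [Real.exp_add, mul_comm (u : ℝ) (Real.log _), mul_comm, Real.exp_mul,
    Real.exp_log (by positivity), Real.rpow_natCast]
  refine h1.trans ?_
  have h3 : (k : ℝ) ^ u / u.factorial = (u : ℝ) ^ u / u.factorial * (k / u) ^ u := by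
    rw [div_pow]; field_simp
  rw [h3]
  exact mul_le_mul_of_nonneg_right h2 (by positivity)

end Binomial

/-! ### The robust soliton distribution -/

section Soliton

lemma rho_nonneg (k d : ℕ) : 0 ≤ rho k d := by
  unfold rho
  split_ifs with h
  · positivity
  · rcases d with _ | d
    · simp
    · push_cast
      have : (0 : ℝ) ≤ (d + 1) * (d + 1 - 1) := by
        rw [add_sub_cancel_right]; positivity
      positivity

lemma sum_rho_eq (k n : ℕ) (hn : 1 ≤ n) :
    ∑ d ∈ Finset.Icc 1 n, rho k d = 1 / k + 1 - 1 / n := by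
  induction n, hn using Nat.le_induction with
  | base => simp [rho]
  | succ n hn ih =>
    have hn' : (0 : ℝ) < n := by exact_mod_cast hn
    rw [Finset.sum_Icc_succ_top (by omega), ih, rho, if_neg (by omega)]
    push_cast
    have : 1 / (((n : ℝ) + 1) * (n + 1 - 1)) = 1 / n - 1 / (n + 1) := by
      rw [add_sub_cancel_right]; field_simp; ring
    rw [this]; ring

/-- This is the design property of the ideal soliton. By Pascal's rule the increment in `t` is a sum
in which the factor `1 / (d * (d - 1))` turns `k.choose d` into `(k - 2).choose (d - 2)`, and
`sum_choose_div_choose` evaluates it. -/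
lemma sum_rho_mul_choose {k : ℕ} (hk : 1 ≤ k) (t : ℕ) (ht : t + 1 ≤ k) :
    ∑ d ∈ Finset.Icc 1 k, rho k d * (t.choose (d - 1) / k.choose d) =
      1 / k * ∑ i ∈ Finset.range (t + 1), 1 / ((k : ℝ) - i) := by
  have hk' : (0 : ℝ) < k := by exact_mod_cast hk
  induction t with
  | zero =>
    rw [Finset.sum_eq_single 1]
    · simp [rho]
    · intro d hd hd1
      rw [Nat.choose_eq_zero_of_lt (by have := (Finset.mem_Icc.1 hd).1; omega)]
      simp
    · intro h
      exact absurd (Finset.mem_Icc.2 ⟨le_rfl, hk⟩) h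
  | succ t ih =>
    have ih := ih (by omega)
    rw [Finset.sum_range_succ, mul_add, ← ih, sum_Icc_one_eq, sum_Icc_one_eq]
    obtain ⟨N, rfl⟩ : ∃ N, k = N + 2 := ⟨k - 2, by omega⟩
    have htN : t ≤ N := by omega
    have key : ∑ e ∈ Finset.range (N + 1), rho (N + 2) (e + 2) *
        ((t.choose e : ℝ) / (N + 2).choose (e + 2)) = 1 / ((N + 2 : ℕ) : ℝ) *
          (1 / (((N + 2 : ℕ) : ℝ) - ((t + 1 : ℕ) : ℝ))) := by
      have e1 : ∀ e ∈ Finset.range (N + 1), rho (N + 2) (e + 2) *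
          ((t.choose e : ℝ) / (N + 2).choose (e + 2)) =
          1 / ((N + 2) * (N + 1)) * (t.choose e / N.choose e) := by
        intro e he
        rw [Finset.mem_range] at he
        have h1 : ((N : ℝ) + 1 + 1) * (N + 1).choose (e + 1) =
            (N + 2).choose (e + 2) * (e + 1 + 1) := by
          exact_mod_cast Nat.add_one_mul_choose_eq (N + 1) (e + 1)
        have h2 : ((N : ℝ) + 1) * N.choose e = (N + 1).choose (e + 1) * (e + 1) := by
          exact_mod_cast Nat.add_one_mul_choose_eq N e
        have p1 : (0 : ℝ) < N.choose e := by exact_mod_cast Nat.choose_pos (by omega)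
        have p2 : (0 : ℝ) < (N + 2).choose (e + 2) := by exact_mod_cast Nat.choose_pos (by omega)
        have p3 : (0 : ℝ) < (e : ℝ) + 1 := by positivity
        rw [rho, if_neg (by omega)]
        push_cast
        have h3 : ((N : ℝ) + 2) * (N + 1) * N.choose e =
            (e + 2) * (e + 1) * (N + 2).choose (e + 2) := by
          have : ((N : ℝ) + 2) * (N + 1) * N.choose e = (N + 1 + 1) * ((N + 1) * N.choose e) := by
            ring
          rw [this, h2]
          have : ((N : ℝ) + 1 + 1) * ((N + 1).choose (e + 1) * (e + 1)) =
            ((N + 1 + 1) * (N + 1).choose (e + 1)) * (e + 1) := by ring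
          rw [this, h1]; ring
        have h4 : ((e : ℝ) + 2) * (e + 2 - 1) = (e + 2) * (e + 1) := by ring
        rw [h4, div_mul_div_comm, div_mul_div_comm, one_mul, h3]
      rw [Finset.sum_congr rfl e1, ← Finset.mul_sum]
      have e2 : ∑ e ∈ Finset.range (N + 1), (t.choose e : ℝ) / N.choose e =
          ∑ e ∈ Finset.range (t + 1), (t.choose e : ℝ) / N.choose e := by
        symm
        refine Finset.sum_subset (fun x hx => ?_) fun x _ hx => ?_
        · rw [Finset.mem_range] at hx ⊢; omega
        · rw [Finset.mem_range, not_lt] at hx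
          rw [Nat.choose_eq_zero_of_lt (by omega)]; simp
      rw [e2, sum_choose_div_choose t N htN]
      push_cast
      have p : (0 : ℝ) < N + 1 - t := by
        have : (t : ℝ) ≤ N := by exact_mod_cast htN
        linarith
      have p5 : (N : ℝ) + 2 - (t + 1) = N + 1 - t := by ring
      rw [p5]
      field_simp
    rw [← key, Finset.sum_range_succ', Finset.sum_range_succ' _ (N + 1)]
    have e3 : ∀ e ∈ Finset.range (N + 1), rho (N + 2) (e + 1 + 1) *
        (((t + 1).choose (e + 1 + 1 - 1) : ℝ) / (N + 2).choose (e + 1 + 1)) =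
        rho (N + 2) (e + 1 + 1) * ((t.choose (e + 1 + 1 - 1) : ℝ) / (N + 2).choose (e + 1 + 1)) +
        rho (N + 2) (e + 2) * ((t.choose e : ℝ) / (N + 2).choose (e + 2)) := by
      intro e _
      simp only [Nat.add_sub_cancel, Nat.choose_succ_succ t e]
      push_cast
      ring
    rw [Finset.sum_congr rfl e3, Finset.sum_add_distrib]
    simp
    ring

lemma log_div_le_sum_inv {k : ℕ} (t : ℕ) (ht : t + 1 ≤ k) :
    Real.log (k / ((k : ℝ) - t)) ≤ ∑ i ∈ Finset.range (t + 1), 1 / ((k : ℝ) - i) := by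
  have hk' : (0 : ℝ) < k := by exact_mod_cast (by omega : 0 < k)
  induction t with
  | zero => simp [hk'.ne']
  | succ t ih =>
    have ih := ih (by omega)
    rw [Finset.sum_range_succ]
    refine le_trans ?_ (add_le_add_left ih _)
    have ht' : (t : ℝ) + 1 + 1 ≤ k := by exact_mod_cast ht
    push_cast
    have p1 : (0 : ℝ) < k - t := by linarith
    have p2 : (0 : ℝ) < k - (t + 1) := by linarith
    have e1 : (k : ℝ) / (k - (t + 1)) = k / (k - t) * ((k - t) / (k - (t + 1))) := by
      field_simp
    rw [e1, Real.log_mul (by positivity) (by positivity)]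
    have e2 : Real.log ((k - t) / ((k : ℝ) - (t + 1))) ≤ 1 / (k - (t + 1)) := by
      refine (Real.log_le_sub_one_of_pos (by positivity)).trans (le_of_eq ?_)
      field_simp
      ring
    linarith

/-- Unlike the logarithmic bound, this one does not vanish at `t = 0`, that is, when no block has
been removed. -/
lemma card_div_le_sum_inv {k : ℕ} (t : ℕ) (ht : t + 1 ≤ k) :
    ((t : ℝ) + 1) / k ≤ ∑ i ∈ Finset.range (t + 1), 1 / ((k : ℝ) - i) := by
  have h : ∀ i ∈ Finset.range (t + 1), 1 / (k : ℝ) ≤ 1 / ((k : ℝ) - i) := by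
    intro i hi
    rw [Finset.mem_range] at hi
    have : (i : ℝ) + 1 ≤ k := by exact_mod_cast (by omega : i + 1 ≤ k)
    refine one_div_le_one_div_of_le (by linarith) ?_
    have : (0 : ℝ) ≤ i := by positivity
    linarith
  refine le_trans (le_of_eq ?_) (Finset.sum_le_sum h)
  simp
  ring

end Soliton

end SeF

namespace SeF

/-! ### The robust soliton distribution, continued -/

section Robust

variable {k : ℕ} {c δ : ℝ}

lemma log_div_pos (hk : 1 ≤ k) (hδ : 0 < δ) (hδ1 : δ < 1) : 0 < Real.log (k / δ) := by
  have hk' : (1 : ℝ) ≤ k := by exact_mod_cast hk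
  refine Real.log_pos ?_
  rw [lt_div_iff₀ hδ]; linarith

lemma log_natCast_le (hk : 1 ≤ k) (hδ : 0 < δ) (hδ1 : δ < 1) :
    Real.log k ≤ Real.log (k / δ) := by
  have hk' : (1 : ℝ) ≤ k := by exact_mod_cast hk
  refine Real.log_le_log (by linarith) ?_
  rw [le_div_iff₀ hδ]; nlinarith

lemma solitonR_pos (hc : 0 < c) (hk : 1 ≤ k) (hδ : 0 < δ) (hδ1 : δ < 1) :
    0 < solitonR k c δ := by
  have h1 := log_div_pos hk hδ hδ1
  have hk' : (0 : ℝ) < k := by exact_mod_cast hk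
  unfold solitonR
  positivity

lemma theta_of_lt {d : ℕ} (h : d < ⌊k / solitonR k c δ⌋₊) :
    theta k c δ d = solitonR k c δ / (d * k) := by
  rw [theta, if_pos h]

lemma theta_floor : theta k c δ ⌊k / solitonR k c δ⌋₊ =
    solitonR k c δ / k * Real.log (solitonR k c δ / δ) := by
  rw [theta, if_neg (lt_irrefl _), if_pos rfl]

lemma theta_nonneg (hR : 0 < solitonR k c δ) (h : δ ≤ solitonR k c δ) (hδ : 0 < δ) (d : ℕ) :
    0 ≤ theta k c δ d := by
  have h1 : 0 ≤ Real.log (solitonR k c δ / δ) :=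
    Real.log_nonneg (by rw [le_div_iff₀ hδ]; linarith)
  unfold theta
  split_ifs <;> positivity

/-- The normalization is `1` if the spike is below the range of degrees. -/
lemma beta_eq_one (hk : 1 ≤ k) (hR : 0 < solitonR k c δ) (h : k < solitonR k c δ) :
    beta k c δ = 1 := by
  have hD : ⌊k / solitonR k c δ⌋₊ = 0 := by
    rw [Nat.floor_eq_zero, div_lt_one hR]; exact h
  have h0 : ∀ d ∈ Finset.Icc 1 k, theta k c δ d = 0 := by
    intro d hd
    have := (Finset.mem_Icc.1 hd).1
    rw [theta, hD, if_neg (by omega), if_neg (by omega)]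
  rw [beta, Finset.sum_add_distrib, Finset.sum_eq_zero h0, sum_rho_eq k k hk]
  ring

/-- The spike is negative when `R < δ`, but `log x ≥ 1 - 1 / x` keeps it above `-1 / k`, while `rho`
sums to `1`. -/
lemma half_le_beta (hk : 2 ≤ k) (hR : 0 < solitonR k c δ) (hδ : 0 < δ) (hδ1 : δ < 1) :
    1 / 2 ≤ beta k c δ := by
  have hk' : (2 : ℝ) ≤ k := by exact_mod_cast hk
  have h1 : ∀ d ∈ Finset.Icc 1 k,
      (if d = ⌊k / solitonR k c δ⌋₊ then -(1 / (k : ℝ)) else 0) ≤ theta k c δ d := by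
    intro d _
    unfold theta
    by_cases h : d < ⌊k / solitonR k c δ⌋₊
    · rw [if_pos h, if_neg h.ne]; positivity
    · by_cases h' : d = ⌊k / solitonR k c δ⌋₊
      · rw [if_neg h, if_pos h', if_pos h']
        have h2 := Real.one_sub_inv_le_log_of_pos (x := solitonR k c δ / δ) (by positivity)
        rw [inv_div] at h2
        calc -(1 / (k : ℝ)) ≤ solitonR k c δ / k * (1 - δ / solitonR k c δ) := by
              have : solitonR k c δ / k * (1 - δ / solitonR k c δ) = (solitonR k c δ - δ) / k := by
                field_simp
              rw [this, ← neg_div]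
              gcongr
              linarith
          _ ≤ _ := mul_le_mul_of_nonneg_left h2 (by positivity)
      · rw [if_neg h, if_neg h', if_neg h']
  have h2 := Finset.sum_le_sum h1
  rw [Finset.sum_ite_eq'] at h2
  rw [beta, Finset.sum_add_distrib, sum_rho_eq k k (by omega)]
  have h3 : 1 / (k : ℝ) ≤ 1 / 2 := by gcongr
  have h4 : -(1 / (k : ℝ)) ≤ if ⌊k / solitonR k c δ⌋₊ ∈ Finset.Icc 1 k then -(1 / (k : ℝ)) else 0 := by
    split_ifs
    · exact le_rfl
    · have : 0 ≤ 1 / (k : ℝ) := by positivity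
      linarith
  linarith

/-- The degrees below the spike form a harmonic sum, at most `1 + log k`; the spike contributes at
most `log (k / δ)` since `R ≤ k`. -/
lemma beta_le (hk : 1 ≤ k) (hR : 0 < solitonR k c δ) (hRk : solitonR k c δ ≤ k)
    (hδ : 0 < δ) (hδ1 : δ < 1) :
    beta k c δ ≤ 1 + solitonR k c δ / k * (1 + 2 * Real.log (k / δ)) := by
  have hk' : (0 : ℝ) < k := by exact_mod_cast hk
  have hL := log_div_pos hk hδ hδ1
  have h1 : ∀ d ∈ Finset.Icc 1 k, theta k c δ d ≤ solitonR k c δ / k * (d : ℝ)⁻¹ +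
      (if d = ⌊k / solitonR k c δ⌋₊ then solitonR k c δ / k * Real.log (k / δ) else 0) := by
    intro d hd
    have hd0 : (0 : ℝ) < d := by exact_mod_cast (Finset.mem_Icc.1 hd).1
    have hp : 0 ≤ solitonR k c δ / k * (d : ℝ)⁻¹ := by positivity
    unfold theta
    by_cases h : d < ⌊k / solitonR k c δ⌋₊
    · rw [if_pos h, if_neg h.ne]
      refine le_of_eq ?_
      field_simp
      ring
    · by_cases h' : d = ⌊k / solitonR k c δ⌋₊
      · rw [if_neg h, if_pos h', if_pos h']
        have : solitonR k c δ / k * Real.log (solitonR k c δ / δ) ≤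
            solitonR k c δ / k * Real.log (k / δ) := by gcongr
        linarith
      · rw [if_neg h, if_neg h', if_neg h']
        linarith
  have h2 := Finset.sum_le_sum h1
  rw [Finset.sum_add_distrib, ← Finset.mul_sum, Finset.sum_ite_eq'] at h2
  have h3 : ∑ d ∈ Finset.Icc 1 k, (d : ℝ)⁻¹ ≤ 1 + Real.log (k / δ) := by
    have := harmonic_le_one_add_log k
    rw [harmonic_eq_sum_Icc] at this
    push_cast at this
    have h5 := log_natCast_le hk hδ hδ1
    linarith
  have h4 : (if ⌊k / solitonR k c δ⌋₊ ∈ Finset.Icc 1 k then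
      solitonR k c δ / k * Real.log (k / δ) else 0) ≤ solitonR k c δ / k * Real.log (k / δ) := by
    split_ifs
    · exact le_rfl
    · positivity
  have h5 : solitonR k c δ / k * ∑ d ∈ Finset.Icc 1 k, (d : ℝ)⁻¹ ≤
      solitonR k c δ / k * (1 + Real.log (k / δ)) := by gcongr
  rw [beta, Finset.sum_add_distrib, sum_rho_eq k k hk]
  have e : solitonR k c δ / k * (1 + 2 * Real.log (k / δ)) =
    solitonR k c δ / k * (1 + Real.log (k / δ)) + solitonR k c δ / k * Real.log (k / δ) := by ring
  rw [e]
  linarith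

lemma le_hitProb (t : ℕ) (s : Finset ℕ) (hs : s ⊆ Finset.Icc 1 k) :
    (∑ d ∈ s, (rho k d + theta k c δ d) * (t.choose (d - 1) / k.choose d)) / beta k c δ ≤
      hitProb k c δ t := by
  rw [Finset.sum_div, hitProb]
  refine (Finset.sum_le_sum fun d _ => ?_).trans
    (Finset.sum_le_sum_of_subset_of_nonneg hs fun d _ _ => by positivity)
  rw [mul_div_right_comm]
  refine mul_le_mul_of_nonneg_right (le_max_left _ _) (by positivity)

lemma le_hitProb_single (hβ : 0 < beta k c δ) (t d : ℕ) (hd : d ∈ Finset.Icc 1 k) :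
    theta k c δ d * (t.choose (d - 1) / k.choose d) / beta k c δ ≤ hitProb k c δ t := by
  have h := le_hitProb (c := c) (δ := δ) t {d} (Finset.singleton_subset_iff.2 hd)
  rw [Finset.sum_singleton] at h
  refine le_trans ?_ h
  gcongr
  linarith [rho_nonneg k d]

/-- A given block is among `d + 1` random neighbours with probability `(d + 1) / k`; the other `d`
must then avoid the remaining `u - 1` blocks. -/
lemma choose_div_choose_eq {u d : ℕ} (hd : d + 1 ≤ k) :
    ((k - u).choose d : ℝ) / k.choose (d + 1) =
      (d + 1) / k * ((k - u).choose d / (k - 1).choose d) := by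
  obtain ⟨K, rfl⟩ : ∃ K, k = K + 1 := ⟨k - 1, by omega⟩
  have h := Nat.add_one_mul_choose_eq K d
  have h' : ((K : ℝ) + 1) * K.choose d = (K + 1).choose (d + 1) * (d + 1) := by exact_mod_cast h
  have p1 : (0 : ℝ) < K.choose d := by exact_mod_cast Nat.choose_pos (by omega)
  have p2 : (0 : ℝ) < (K + 1).choose (d + 1) := by exact_mod_cast Nat.choose_pos (by omega)
  have p3 : (0 : ℝ) < (d : ℝ) + 1 := by positivity
  rw [Nat.add_sub_cancel, div_mul_div_comm]
  push_cast
  rw [h', div_eq_div_iff (by positivity) (by positivity)]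
  ring

/-- A set of `d` neighbours, one of which is given, misses `u - 1` other given blocks with
probability at least `1 - (u - 1) d / (k - 1)`. -/
lemma one_sub_le_choose_div_choose {u d : ℕ} (hk : 2 ≤ k) (hu : 1 ≤ u) (huk : u ≤ k)
    (hd : d + 1 ≤ k) :
    1 - ((u : ℝ) - 1) * d / (k - 1) ≤ ((k - u).choose d : ℝ) / (k - 1).choose d := by
  have p1 : (0 : ℝ) < (k - 1).choose d := by exact_mod_cast Nat.choose_pos (by omega)
  rw [le_div_iff₀ p1]
  have h := choose_mul_one_sub_le (k - 1) d (by omega) (u - 1) (by omega)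
  rw [show k - 1 - (u - 1) = k - u by omega, Nat.cast_sub hu, Nat.cast_sub (by omega)] at h
  push_cast at h
  linarith

end Robust

/-! ### Terms of the first moment bound -/

section Terms

variable {k u : ℕ} {L lam : ℝ}

lemma choose_le_exp_mul (hkL : (k : ℝ) ≤ Real.exp L) (u : ℕ) :
    (k.choose u : ℝ) ≤ Real.exp (u * L) := by
  have h : (k.choose u : ℝ) ≤ (k : ℝ) ^ u := by exact_mod_cast Nat.choose_le_pow k u
  refine h.trans ?_
  rw [Real.exp_nat_mul]
  exact pow_le_pow_left₀ (by positivity) hkL u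

lemma term_self_le_of_three_mul_le (hkL : (k : ℝ) ≤ Real.exp L) (hL : 0 ≤ L) (hu : 1 ≤ u)
    (h : 3 * L ≤ lam) :
    (k.choose u : ℝ) / u.choose u * Real.exp (-(u * lam)) ≤ Real.exp (-(2 * L)) := by
  have hu' : (1 : ℝ) ≤ u := by exact_mod_cast hu
  rw [Nat.choose_self, Nat.cast_one, div_one]
  refine (mul_le_mul_of_nonneg_right (choose_le_exp_mul hkL u) (Real.exp_pos _).le).trans ?_
  rw [← Real.exp_add, Real.exp_le_exp]
  nlinarith [mul_le_mul_of_nonneg_left h (by linarith : (0 : ℝ) ≤ u)]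

/-- For `u` near `k`: counting complements, the entropy is only `(k - u) * L`. -/
lemma term_self_le_of_symm (hkL : (k : ℝ) ≤ Real.exp L) (huk : u ≤ k)
    (h : 3 * L * (k - u + 1) ≤ u * lam) (hL : 0 ≤ L) :
    (k.choose u : ℝ) / u.choose u * Real.exp (-(u * lam)) ≤ Real.exp (-(2 * L)) := by
  have hu' : (u : ℝ) ≤ k := by exact_mod_cast huk
  rw [Nat.choose_self, Nat.cast_one, div_one, ← Nat.choose_symm huk]
  refine (mul_le_mul_of_nonneg_right (choose_le_exp_mul hkL (k - u)) (Real.exp_pos _).le).trans ?_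
  rw [← Real.exp_add, Real.exp_le_exp, Nat.cast_sub huk]
  nlinarith [mul_nonneg hL (sub_nonneg.2 hu')]

lemma term_self_le_of_two_pow (h : k + 2 * L ≤ u * lam) :
    (k.choose u : ℝ) / u.choose u * Real.exp (-(u * lam)) ≤ Real.exp (-(2 * L)) := by
  rw [Nat.choose_self, Nat.cast_one, div_one]
  have h1 : (k.choose u : ℝ) ≤ 2 ^ k := by exact_mod_cast Nat.choose_le_two_pow k u
  have h2 : (2 : ℝ) ^ k ≤ Real.exp k := by
    rw [← Real.exp_one_pow]
    exact pow_le_pow_left₀ (by norm_num) (by linarith [Real.add_one_le_exp (1 : ℝ)]) k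
  refine (mul_le_mul_of_nonneg_right (h1.trans h2) (Real.exp_pos _).le).trans ?_
  rw [← Real.exp_add, Real.exp_le_exp]
  linarith

/-- The geometric part sums to at most `δ / 2`. The exponential is `(δ / k) ^ 2`, and `k` copies
make `δ ^ 2 / k ≤ δ / 2`. -/
lemma sum_le_of_term_le {δ : ℝ} (hk : 2 ≤ k) (hδ : 0 < δ) (hδ1 : δ < 1) {F : ℕ → ℝ}
    (h : ∀ u ∈ Finset.Icc 1 k, F u ≤ δ / 2 * (1 / 2) ^ u + Real.exp (-(2 * Real.log (k / δ)))) :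
    ∑ u ∈ Finset.Icc 1 k, F u ≤ δ := by
  have hk' : (2 : ℝ) ≤ k := by exact_mod_cast hk
  refine (Finset.sum_le_sum h).trans ?_
  rw [Finset.sum_add_distrib, ← Finset.mul_sum, Finset.sum_const, nsmul_eq_mul, Nat.card_Icc,
    Nat.add_sub_cancel]
  have h1 : ∑ u ∈ Finset.Icc 1 k, (1 / 2 : ℝ) ^ u ≤ 1 := by
    rw [sum_Icc_one_eq]
    have h2 : ∀ e ∈ Finset.range k, (1 / 2 : ℝ) ^ (e + 1) = 1 / 2 * (1 / 2) ^ e := by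
      intro e _; ring
    rw [Finset.sum_congr rfl h2, ← Finset.mul_sum, geom_sum_eq (by norm_num)]
    have : (0 : ℝ) ≤ (1 / 2) ^ k := by positivity
    have h3 : ((1 / 2 : ℝ) ^ k - 1) / (1 / 2 - 1) = 2 * (1 - (1 / 2) ^ k) := by
      rw [div_eq_iff (by norm_num)]; ring
    rw [h3]; linarith
  have h3 : Real.exp (-(2 * Real.log (k / δ))) = (δ / k) ^ 2 := by
    rw [← Real.exp_log (show (0 : ℝ) < (δ / k) ^ 2 by positivity), Real.log_pow, ← inv_div,
      Real.log_inv]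
    congr 1
    push_cast
    ring
  rw [h3]
  have h4 : (k : ℝ) * (δ / k) ^ 2 = δ * (δ / k) := by field_simp
  have h5 : δ / k ≤ 1 / 2 := by
    rw [div_le_div_iff₀ (by linarith) (by norm_num)]; linarith
  rw [h4]
  nlinarith [mul_le_mul_of_nonneg_left h5 hδ.le, mul_le_mul_of_nonneg_left h1 hδ.le]

end Terms

end SeF

namespace SeF

/-! ### Crude estimates: bounded `k`, and spikes at bounded degree or absent -/

section Regimes

variable {k : ℕ} {c δ M : ℝ} {n : ℕ}

lemma le_exp_log_div (hk : 1 ≤ k) (hδ : 0 < δ) (hδ1 : δ < 1) :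
    (k : ℝ) ≤ Real.exp (Real.log (k / δ)) := by
  have hk' : (1 : ℝ) ≤ k := by exact_mod_cast hk
  rw [Real.exp_log (by positivity), le_div_iff₀ hδ]
  nlinarith

/-- A bounded number of blocks: the droplets of degree one suffice. -/
lemma three_mul_le_of_le (hc : 0 < c) (hk : 2 ≤ k) (hδ : 0 < δ) (hδ1 : δ < 1)
    (hR : solitonR k c δ ≤ k) {K : ℝ} (hK : (k : ℝ) ≤ K)
    (hn : 15 * K ^ 2 * (√k * Real.log (k / δ) ^ 2) ≤ n) (t : ℕ) :
    3 * Real.log (k / δ) ≤ n * hitProb k c δ t := by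
  have hk' : (2 : ℝ) ≤ k := by exact_mod_cast hk
  have hR0 := solitonR_pos hc (by omega) hδ hδ1 (k := k)
  have hβ : 0 < beta k c δ := by linarith [half_le_beta hk hR0 hδ hδ1]
  have hβ2 := beta_le (by omega) hR0 hR hδ hδ1
  set L := Real.log (k / δ) with hLdef
  have hL : 2 / 3 < L := by
    have h1 := log_natCast_le (k := k) (by omega) hδ hδ1
    have h2 : Real.log 2 ≤ Real.log k := Real.log_le_log (by norm_num) hk'
    have := Real.log_two_gt_d9
    linarith
  have hβ5 : beta k c δ ≤ 5 * L := by
    have h1 : solitonR k c δ / k ≤ 1 := by rw [div_le_one (by linarith)]; exact hR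
    have h2 : solitonR k c δ / k * (1 + 2 * L) ≤ 1 * (1 + 2 * L) := by gcongr
    linarith
  have hθ : 0 ≤ theta k c δ 1 := by
    by_cases h : 1 < ⌊k / solitonR k c δ⌋₊
    · rw [theta_of_lt h]; positivity
    · have h1 : ⌊k / solitonR k c δ⌋₊ = 1 := by
        have : 1 ≤ ⌊k / solitonR k c δ⌋₊ := by
          rw [Nat.one_le_floor_iff, le_div_iff₀ hR0]; linarith
        omega
      have h2 : k / solitonR k c δ < 2 := by
        have := Nat.lt_floor_add_one (k / solitonR k c δ)
        rw [h1] at this; push_cast at this; linarith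
      rw [div_lt_iff₀ hR0] at h2
      exact theta_nonneg hR0 (by linarith) hδ 1
  have h := le_hitProb (c := c) (δ := δ) t {1}
    (Finset.singleton_subset_iff.2 (Finset.mem_Icc.2 ⟨le_rfl, (by omega : 1 ≤ k)⟩))
  rw [Finset.sum_singleton] at h
  -- Degree one has `rho k 1 = 1 / k`, and the one neighbour is the right block with probability `1
  -- / k`. Against `beta ≤ 5 * L`, this explains `15 * K ^ 2` and `L ^ 2`.
  have h1 : 1 / (k : ℝ) * (1 / k) / (5 * L) ≤ hitProb k c δ t := by
    refine le_trans ?_ h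
    have : rho k 1 = 1 / k := by simp [rho]
    simp only [Nat.sub_self, Nat.choose_zero_right, Nat.choose_one_right, Nat.cast_one]
    rw [this]
    gcongr
    linarith
  have hs : 1 ≤ √(k : ℝ) := by rw [Real.one_le_sqrt]; linarith
  have h2 : 15 * (k : ℝ) ^ 2 * (1 * L ^ 2) ≤ n := by
    refine le_trans ?_ hn
    gcongr
  calc 3 * L = 15 * (k : ℝ) ^ 2 * (1 * L ^ 2) * (1 / (k : ℝ) * (1 / k) / (5 * L)) := by
        have : L ≠ 0 := by linarith
        field_simp
        norm_num
    _ ≤ n * hitProb k c δ t := by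
        refine mul_le_mul h2 h1 (by positivity) (by positivity)

lemma le_hitProb_ideal (hk : 1 ≤ k) (hβ : 0 < beta k c δ) (t : ℕ) (ht : t + 1 ≤ k) {E : ℝ}
    (hE : E ≤ ∑ d ∈ Finset.Icc 1 k, theta k c δ d * (t.choose (d - 1) / k.choose d)) :
    (1 / k * ∑ i ∈ Finset.range (t + 1), 1 / ((k : ℝ) - i) + E) / beta k c δ ≤
      hitProb k c δ t := by
  refine le_trans ?_ (le_hitProb (c := c) (δ := δ) t _ le_rfl)
  rw [← sum_rho_mul_choose hk t ht]
  gcongr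
  simp only [add_mul, Finset.sum_add_distrib]
  linarith

/-- Extremely small failure probabilities, where the distribution has no spike. -/
lemma term_le_of_lt_solitonR (hc : 0 < c) (hk : 2 ≤ k) (hδ : 0 < δ) (hδ1 : δ < 1)
    (hR : k < solitonR k c δ) (hM : 6 ≤ M)
    (hn : k + M * (solitonR k c δ * Real.log (k / δ)) ≤ n) {u : ℕ} (hu : u ∈ Finset.Icc 1 k) :
    (k.choose u : ℝ) / u.choose u * Real.exp (-(u * (n * hitProb k c δ (k - u)))) ≤
      Real.exp (-(2 * Real.log (k / δ))) := by
  obtain ⟨hu1, huk⟩ := Finset.mem_Icc.1 hu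
  have hk' : (2 : ℝ) ≤ k := by exact_mod_cast hk
  have hu1' : (1 : ℝ) ≤ u := by exact_mod_cast hu1
  have huk' : (u : ℝ) ≤ k := by exact_mod_cast huk
  have hR0 := solitonR_pos hc (by omega) hδ hδ1 (k := k)
  have hL := log_div_pos (k := k) (by omega) hδ hδ1
  have hkL := le_exp_log_div (k := k) (by omega) hδ hδ1
  have hβ := beta_eq_one (by omega) hR0 hR
  have hθ := theta_nonneg hR0 (by linarith) hδ
  have h := le_hitProb_ideal (c := c) (δ := δ) (by omega) (by rw [hβ]; norm_num) (k - u)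
    (by omega) (Finset.sum_nonneg fun d _ => mul_nonneg (hθ d) (by positivity))
  rw [hβ, add_zero, div_one] at h
  set S := ∑ i ∈ Finset.range (k - u + 1), 1 / ((k : ℝ) - i) with hS
  have hS1 := card_div_le_sum_inv (k := k) (k - u) (by omega)
  rw [← hS, Nat.cast_sub huk] at hS1
  set L := Real.log (k / δ) with hLdef
  have hn1 : 6 * (k * L) ≤ n := by
    have h1 : 6 * (k * L) ≤ M * (solitonR k c δ * L) := by gcongr
    linarith
  have hlam : 6 * L * S ≤ n * hitProb k c δ (k - u) := by
    have hS0 : 0 ≤ S := le_trans (div_nonneg (by linarith) (by linarith)) hS1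
    calc 6 * L * S = 6 * (k * L) * (1 / k * S) := by field_simp
      _ ≤ _ := mul_le_mul hn1 h (by positivity) (by positivity)
  -- Since `S ≥ (k - u + 1) / k`, it is at least `1 / 2` for `u ≤ k / 2`; for larger `u` it is
  -- proportional to the entropy in `term_self_le_of_symm`.
  by_cases hhalf : 2 * (u : ℝ) ≤ k
  · refine term_self_le_of_three_mul_le hkL hL.le hu1 (le_trans ?_ hlam)
    have : 1 / 2 ≤ S := by
      refine le_trans ?_ hS1
      rw [div_le_div_iff₀ (by norm_num) (by linarith)]; linarith
    nlinarith
  · refine term_self_le_of_symm hkL huk ?_ hL.le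
    push Not at hhalf
    have h1 : ((k : ℝ) / 2) * (6 * L * (((k : ℝ) - u + 1) / k)) ≤
        u * (n * hitProb k c δ (k - u)) := by
      refine mul_le_mul (by linarith) (le_trans ?_ hlam) ?_ (by linarith)
      · gcongr
      · have : (0 : ℝ) ≤ k - u + 1 := by linarith
        positivity
    refine le_trans (le_of_eq ?_) h1
    field_simp
    ring

/-- A spike at a bounded degree. -/
lemma term_le_of_le_four_mul (hc : 0 < c) (hk : 16 ≤ k) (hδ : 0 < δ) (hδ1 : δ < 1)
    (hR : solitonR k c δ ≤ k) (hR4 : k < 4 * solitonR k c δ) (hM : 1024 + 512 / c ≤ M)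
    (hn : k + M * (solitonR k c δ * Real.log (k / δ)) ≤ n) {u : ℕ} (hu : u ∈ Finset.Icc 1 k) :
    (k.choose u : ℝ) / u.choose u * Real.exp (-(u * (n * hitProb k c δ (k - u)))) ≤
      Real.exp (-(2 * Real.log (k / δ))) := by
  obtain ⟨hu1, huk⟩ := Finset.mem_Icc.1 hu
  have hk' : (16 : ℝ) ≤ k := by exact_mod_cast hk
  have hu1' : (1 : ℝ) ≤ u := by exact_mod_cast hu1
  have huk' : (u : ℝ) ≤ k := by exact_mod_cast huk
  have hR0 := solitonR_pos hc (by omega) hδ hδ1 (k := k)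
  have hkL := le_exp_log_div (k := k) (by omega) hδ hδ1
  have hβ : 0 < beta k c δ := by linarith [half_le_beta (by omega) hR0 hδ hδ1]
  have hβ2 := beta_le (by omega) hR0 hR hδ hδ1
  have hθ := theta_nonneg hR0 (by linarith) hδ
  have hLk := log_natCast_le (k := k) (by omega) hδ hδ1
  have hRdef : solitonR k c δ = c * √k * Real.log (k / δ) := rfl
  set L := Real.log (k / δ) with hLdef
  set R := solitonR k c δ with hRR
  have hlog4 : 2 * Real.log 4 ≤ L := by
    refine le_trans ?_ hLk
    have : 2 * Real.log 4 = Real.log 16 := by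
      rw [show (16 : ℝ) = 4 ^ 2 by norm_num, Real.log_pow]; norm_num
    rw [this]
    exact Real.log_le_log (by norm_num) hk'
  have hL2 : 2 ≤ L := by
    have h1 : Real.log 4 = 2 * Real.log 2 := by
      rw [show (4 : ℝ) = 2 ^ 2 by norm_num, Real.log_pow]; norm_num
    have := Real.log_two_gt_d9
    linarith
  -- From `R > k / 4`: the first factor is at least `1 / 4`, and the logarithm at least `L - log 4 ≥
  -- L / 2`, as `k ≥ 16`.
  have hspike : L / 8 ≤ R / k * Real.log (R / δ) := by
    have h1 : L - Real.log 4 ≤ Real.log (R / δ) := by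
      rw [hLdef, ← Real.log_div (by positivity) (by norm_num)]
      refine Real.log_le_log (by positivity) ?_
      rw [div_div, div_le_div_iff₀ (by positivity) hδ]
      nlinarith
    have h2 : 1 / 4 ≤ R / k := by
      rw [div_le_div_iff₀ (by norm_num) (by linarith)]; linarith
    calc L / 8 = 1 / 4 * (L / 2) := by ring
      _ ≤ _ := mul_le_mul h2 (by linarith) (by linarith) (by positivity)
  have hDpos : 1 ≤ ⌊k / R⌋₊ := by rw [Nat.one_le_floor_iff, le_div_iff₀ hR0]; linarith
  have hD3 : ⌊k / R⌋₊ ≤ 3 := by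
    have : ⌊k / R⌋₊ < 4 := by
      rw [Nat.floor_lt (by positivity), div_lt_iff₀ hR0]; push_cast; linarith
    omega
  have hθD : theta k c δ ⌊k / R⌋₊ = R / k * Real.log (R / δ) := theta_floor
  have hnβ : M / 16 * k ≤ n / beta k c δ := by
    rw [le_div_iff₀ hβ]
    have h1 : beta k c δ ≤ 4 * L := by
      have h1 : R / k ≤ 1 := by rw [div_le_one (by linarith)]; exact hR
      have h2 : R / k * (1 + 2 * L) ≤ 1 * (1 + 2 * L) := by gcongr
      linarith
    have hM0 : 0 ≤ M := by
      have : 0 ≤ 512 / c := by positivity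
      linarith
    calc M / 16 * k * beta k c δ ≤ M / 16 * k * (4 * L) := by gcongr
      _ = M * (k / 4 * L) := by ring
      _ ≤ M * (R * L) := by gcongr; linarith
      _ ≤ n := by linarith
  have hc' : 0 ≤ 512 / c := by positivity
  have hlam : ∀ d ∈ Finset.Icc 1 k, M / 16 * k * (theta k c δ d *
      (((k - u).choose (d - 1) : ℝ) / k.choose d)) ≤ n * hitProb k c δ (k - u) := by
    intro d hd
    have h1 := le_hitProb_single hβ (k - u) d hd
    calc _ ≤ n / beta k c δ * (theta k c δ d * (((k - u).choose (d - 1) : ℝ) / k.choose d)) :=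
          mul_le_mul_of_nonneg_right hnβ (mul_nonneg (hθ d) (by positivity))
      _ = n * (theta k c δ d * (((k - u).choose (d - 1) : ℝ) / k.choose d) / beta k c δ) := by
          ring
      _ ≤ _ := mul_le_mul_of_nonneg_left h1 (by positivity)
  -- For `u ≤ k / 4` a droplet at the spike, of degree at most three, avoids the other `u - 1`
  -- blocks with probability at least `1 / 2`. For larger `u` droplets of degree one suffice against
  -- `2 ^ k`.
  by_cases h4 : 4 * (u : ℝ) ≤ k
  · refine term_self_le_of_three_mul_le hkL (by linarith) hu1 ?_
    refine le_trans ?_ (hlam ⌊k / R⌋₊ (Finset.mem_Icc.2 ⟨hDpos, by omega⟩))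
    rw [hθD]
    have h5 : 1 / (2 * k : ℝ) ≤ ((k - u).choose (⌊k / R⌋₊ - 1) : ℝ) / k.choose ⌊k / R⌋₊ := by
      obtain ⟨d, hd⟩ : ∃ d, ⌊k / R⌋₊ = d + 1 := ⟨⌊k / R⌋₊ - 1, by omega⟩
      rw [hd, Nat.add_sub_cancel, choose_div_choose_eq (by omega)]
      have h6 := one_sub_le_choose_div_choose (d := d) (by omega) hu1 huk (by omega)
      have hd2 : (d : ℝ) ≤ 2 := by exact_mod_cast (by omega : d ≤ 2)
      have hd0 : (0 : ℝ) ≤ d := by positivity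
      have h7 : ((u : ℝ) - 1) * d / (k - 1) ≤ 1 / 2 := by
        rw [div_le_div_iff₀ (by linarith) (by norm_num)]
        nlinarith
      calc 1 / (2 * k : ℝ) = 1 / k * (1 / 2) := by field_simp
        _ ≤ (d + 1) / k * (((k - u).choose d : ℝ) / (k - 1).choose d) := by
          refine mul_le_mul ?_ (by linarith) (by norm_num) (by positivity)
          gcongr; linarith
    have hML : 1024 * L ≤ M * L := by gcongr; linarith
    calc 3 * L ≤ M / 32 * (L / 8) := by linarith
      _ = M / 16 * k * (L / 8 * (1 / (2 * k))) := by field_simp; ring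
      _ ≤ _ := by
        have hM0 : 0 ≤ M := by linarith
        have hs0 : 0 ≤ R / k * Real.log (R / δ) := by linarith
        gcongr
  · push Not at h4
    refine term_self_le_of_two_pow ?_
    have h1 := hlam 1 (Finset.mem_Icc.2 ⟨le_rfl, by omega⟩)
    have hθ1 : 1 / 4 ≤ theta k c δ 1 := by
      by_cases h : 1 < ⌊k / R⌋₊
      · rw [theta_of_lt h, ← hRR]
        push_cast
        rw [one_mul, div_le_div_iff₀ (by norm_num) (by linarith)]; linarith
      · have h2 : ⌊k / R⌋₊ = 1 := by omega
        rw [h2] at hθD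
        rw [hθD]; linarith
    have h2 : M / 64 ≤ n * hitProb k c δ (k - u) := by
      refine le_trans ?_ h1
      simp only [Nat.sub_self, Nat.choose_zero_right, Nat.choose_one_right, Nat.cast_one]
      have hM0 : 0 ≤ M := by linarith
      calc M / 64 = M / 16 * k * (1 / 4 * (1 / k)) := by field_simp; ring
        _ ≤ _ := by gcongr
    have h3 : (k : ℝ) / 4 * (M / 64) ≤ u * (n * hitProb k c δ (k - u)) := by
      refine mul_le_mul (by linarith) h2 ?_ (by linarith)
      linarith
    refine le_trans ?_ h3
    -- `R ≤ k` bounds `L` linearly in `k`; the term `512 / c` in `M` absorbs `2 * L`.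
    have hLc : L ≤ k / c := by
      have hs : 1 ≤ √(k : ℝ) := by rw [Real.one_le_sqrt]; linarith
      rw [le_div_iff₀ hc]
      have : c * L * 1 ≤ c * L * √k := by gcongr
      linarith
    have h5 : 512 / c * k = 512 * (k / c) := by ring
    have h6 : (1024 + 512 / c) * k ≤ M * k := by gcongr
    linarith

end Regimes

end SeF

namespace SeF

/-! ### The main regime, with the spike at degree at least four -/

section LargeRegime

variable {k : ℕ} {c δ M : ℝ} {n : ℕ}

/-- For degrees up to about `k / (2 * max u R)`, a droplet containing the given block avoids the
other `u - 1` with probability at least `1 / 2`. The degree cancels between `theta` and `d / k`, so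
each contributes at least `R / (2 * k ^ 2)`. The maximum with `R` keeps these degrees below the
spike. -/
lemma le_sum_theta (hk : 2 ≤ k) (hR : 0 < solitonR k c δ) (hRk : 4 * solitonR k c δ ≤ k)
    (hθ : ∀ d, 0 ≤ theta k c δ d) {u : ℕ} (hu : 1 ≤ u) (huk : u ≤ k) :
    1 / k * (solitonR k c δ / (4 * max (u : ℝ) (solitonR k c δ))) ≤
      ∑ d ∈ Finset.Icc 1 k, theta k c δ d * (((k - u).choose (d - 1) : ℝ) / k.choose d) := by
  set R := solitonR k c δ with hRR
  set m := max (u : ℝ) R with hm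
  have hk' : (2 : ℝ) ≤ k := by exact_mod_cast hk
  have hu' : (1 : ℝ) ≤ u := by exact_mod_cast hu
  have huk' : (u : ℝ) ≤ k := by exact_mod_cast huk
  have hum : (u : ℝ) ≤ m := le_max_left _ _
  have hRm : R ≤ m := le_max_right _ _
  have hm0 : 0 < m := by linarith
  set G := ⌈k / (2 * m)⌉₊ with hG
  have hGD : G + 1 ≤ ⌊k / R⌋₊ := by
    refine Nat.le_floor ?_
    push_cast
    have h1 : (G : ℝ) < k / (2 * m) + 1 := Nat.ceil_lt_add_one (by positivity)
    have h2 : k / (2 * m) ≤ k / (2 * R) := by gcongr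
    have h3 : k / R = k / (2 * R) + k / (2 * R) := by field_simp; ring
    have h4 : 2 ≤ k / (2 * R) := by rw [le_div_iff₀ (by positivity)]; linarith
    linarith
  have hDk : G + 1 ≤ k := by
    have h1 : (G : ℝ) < k / (2 * m) + 1 := Nat.ceil_lt_add_one (by positivity)
    have h2 : k / (2 * m) ≤ k / (2 * 1) := by gcongr; linarith
    have : (G : ℝ) < k := by linarith
    have : G < k := by exact_mod_cast this
    omega
  have hterm : ∀ e ∈ Finset.range G, R / (2 * k ^ 2) ≤
      theta k c δ (e + 1) * (((k - u).choose (e + 1 - 1) : ℝ) / k.choose (e + 1)) := by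
    intro e he
    rw [Finset.mem_range] at he
    have he' : (e : ℝ) < k / (2 * m) := Nat.lt_ceil.1 he
    rw [lt_div_iff₀ (by positivity)] at he'
    have he0 : (0 : ℝ) ≤ e := by positivity
    rw [theta_of_lt (by rw [← hRR]; omega), ← hRR, Nat.add_sub_cancel, choose_div_choose_eq (by omega)]
    have h6 := one_sub_le_choose_div_choose (d := e) hk hu huk (by omega)
    have h7 : ((u : ℝ) - 1) * e / (k - 1) ≤ 1 / 2 := by
      rw [div_le_div_iff₀ (by linarith) (by norm_num)]
      have h8 : (u : ℝ) * e ≤ m * e := by gcongr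
      by_cases h9 : e = 0
      · subst h9; push_cast; linarith
      · have : (1 : ℝ) ≤ e := by exact_mod_cast Nat.one_le_iff_ne_zero.2 h9
        nlinarith
    calc R / (2 * k ^ 2) = R / (((e + 1 : ℕ) : ℝ) * k) * ((e + 1) / k * (1 / 2)) := by
          push_cast; field_simp
      _ ≤ _ := mul_le_mul_of_nonneg_left
          (mul_le_mul_of_nonneg_left (by linarith) (by positivity)) (by positivity)
  have hsub : ∑ e ∈ Finset.range G, theta k c δ (e + 1) *
      (((k - u).choose (e + 1 - 1) : ℝ) / k.choose (e + 1)) ≤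
      ∑ e ∈ Finset.range k, theta k c δ (e + 1) *
      (((k - u).choose (e + 1 - 1) : ℝ) / k.choose (e + 1)) := by
    refine Finset.sum_le_sum_of_subset_of_nonneg (fun x hx => ?_)
      fun d _ _ => mul_nonneg (hθ _) (by positivity)
    rw [Finset.mem_range] at hx ⊢; omega
  rw [sum_Icc_one_eq]
  refine le_trans ?_ ((Finset.sum_le_sum hterm).trans hsub)
  rw [Finset.sum_const, Finset.card_range, nsmul_eq_mul]
  calc 1 / k * (R / (4 * m)) = k / (2 * m) * (R / (2 * k ^ 2)) := by field_simp; norm_num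
    _ ≤ G * (R / (2 * k ^ 2)) := by gcongr; exact Nat.le_ceil _

/-- The overhead `M * R * L` pays for the normalization and leaves a surplus `2 * R`, which later
makes up for rounding the position of the spike. -/
lemma add_two_mul_le_div_beta (hk : 2 ≤ k) (hR : 0 < solitonR k c δ)
    (hRk : 4 * solitonR k c δ ≤ k) (hδ : 0 < δ) (hδ1 : δ < 1) (hL : 1 ≤ Real.log (k / δ))
    (hM : 7 ≤ M) (hn : k + M * (solitonR k c δ * Real.log (k / δ)) ≤ n) :
    k + 2 * solitonR k c δ ≤ n / beta k c δ := by
  have hk' : (2 : ℝ) ≤ k := by exact_mod_cast hk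
  have hβ : 0 < beta k c δ := by linarith [half_le_beta hk hR hδ hδ1]
  have hβ2 := beta_le (by omega) hR (by linarith) hδ hδ1
  set L := Real.log (k / δ)
  set R := solitonR k c δ
  rw [le_div_iff₀ hβ]
  have h1 : R / k * (1 + 2 * L) ≤ R / k * (3 * L) := by gcongr; linarith
  have h2 : (k + 2 * R) * beta k c δ ≤ (k + 2 * R) * (1 + R / k * (3 * L)) := by
    gcongr; linarith
  have h3 : (k + 2 * R) * (1 + R / k * (3 * L)) = k + 2 * R + 3 * (R * L) + 6 * (R / k) * (R * L) := by
    field_simp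
    ring
  have h4 : R / k ≤ 1 / 4 := by
    rw [div_le_div_iff₀ (by linarith) (by norm_num)]; linarith
  have h5 : 0 ≤ R * L := by positivity
  have h6 : R / k * (R * L) ≤ 1 / 4 * (R * L) := by gcongr
  have h7 : R * 1 ≤ R * L := by gcongr
  have h8 : 7 * (R * L) ≤ M * (R * L) := by gcongr
  linarith

/-- Residual sets that are not small: the droplets of degree below the spike. -/
lemma term_le_of_lt {R L lam : ℝ} {u : ℕ} (hu : 1 ≤ u) (huk : u ≤ k) (hR : 128 ≤ R)
    (hRu : R / 8 < u) (hRL : 2048 * L ≤ R) (hRL2 : 256 * (L * k) ≤ R ^ 2)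
    (hlam : Real.log (k / u) + R / (4 * max (u : ℝ) R) ≤ lam) :
    (k.choose ⌊min (u : ℝ) R / 8⌋₊ : ℝ) / u.choose ⌊min (u : ℝ) R / 8⌋₊ *
      Real.exp (-(⌊min (u : ℝ) R / 8⌋₊ * lam)) ≤ Real.exp (-(2 * L)) := by
  have hu' : (1 : ℝ) ≤ u := by exact_mod_cast hu
  have huk' : (u : ℝ) ≤ k := by exact_mod_cast huk
  set b := min (u : ℝ) R / 8 with hb
  have hb1 : 2 ≤ b := by
    have : 16 ≤ min (u : ℝ) R := le_min (by linarith) (by linarith)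
    linarith
  have hbu : b ≤ u / 8 := by rw [hb]; gcongr; exact min_le_left _ _
  set j := ⌊b⌋₊ with hj
  have hjb : (j : ℝ) ≤ b := Nat.floor_le (by linarith)
  have hbj : b / 2 ≤ j := by
    have := Nat.lt_floor_add_one b
    rw [← hj] at this
    linarith
  have hju : 2 * j ≤ u := by
    have : (2 : ℝ) * j ≤ u := by linarith
    exact_mod_cast this
  have h1 := choose_div_choose_le_exp hu huk j hju
  refine (mul_le_mul_of_nonneg_right h1 (Real.exp_pos _).le).trans ?_
  rw [← Real.exp_add, Real.exp_le_exp]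
  have hj0 : (0 : ℝ) ≤ j := by positivity
  have h2 := mul_le_mul_of_nonneg_left hlam hj0
  have h3 : (j : ℝ) ^ 2 / u = j * (j / u) := by ring
  -- The terms `j * log (k / u)` cancel. With `j ≤ min u R / 8`, the loss `j / u` is at most half of
  -- the gain from `theta`.
  suffices h : 2 * L ≤ j * (R / (4 * max (u : ℝ) R) - j / u) by
    rw [h3]
    linarith
  rcases le_total (u : ℝ) R with huR | huR
  · rw [max_eq_right huR]
    have hbe : b = u / 8 := by rw [hb, min_eq_left huR]
    have h4 : (j : ℝ) / u ≤ 1 / 8 := by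
      rw [div_le_iff₀ (by linarith)]; linarith
    have h5 : R / (4 * R) = 1 / 4 := by field_simp
    rw [h5]
    calc 2 * L ≤ u / 16 * (1 / 8) := by linarith
      _ ≤ j * (1 / 4 - j / u) := by
        refine mul_le_mul (by linarith) (by linarith) (by norm_num) hj0
  · rw [max_eq_left huR]
    have hbe : b = R / 8 := by rw [hb, min_eq_right huR]
    have h4 : (j : ℝ) / u ≤ R / 8 / u := by gcongr; linarith
    have h5 : R / (4 * u) - R / 8 / u = R / (8 * u) := by field_simp; ring
    have h6 : R / (8 * k) ≤ R / (8 * u) := by gcongr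
    calc 2 * L ≤ R / 16 * (R / (8 * k)) := by
          rw [div_mul_div_comm, le_div_iff₀ (by linarith)]
          nlinarith
      _ ≤ j * (R / (4 * u) - j / u) := by
        refine mul_le_mul (by linarith) (by linarith) (by positivity) hj0

/-- Small residual sets: the droplets whose degree is at the spike. -/
lemma term_le_of_le {R lam : ℝ} {u : ℕ} (hu : 1 ≤ u) (huk : u ≤ k) (hδ : 0 < δ) (hδ1 : δ < 1)
    (hR : 128 ≤ R)
    (hlam1 : u = 1 → Real.log k + Real.log (R / δ) ≤ lam)
    (hlam : Real.log (k / u) + 3 / 4 * Real.log (R / δ) ≤ lam) :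
    (k.choose u : ℝ) / u.choose u * Real.exp (-(u * lam)) ≤ δ / 2 * (1 / 2) ^ u := by
  have hk' : (1 : ℝ) ≤ k := by exact_mod_cast (by omega : 1 ≤ k)
  rw [Nat.choose_self, Nat.cast_one, div_one]
  -- The factor `3 / 4` would give only `δ ^ (3 / 4)` for `u = 1`, where the full logarithm is
  -- needed; for `u ≥ 2` the power of `δ` is at least `3 / 2`.
  rcases eq_or_ne u 1 with rfl | hu1
  · have h := hlam1 rfl
    rw [Nat.choose_one_right, Nat.cast_one, one_mul, pow_one]
    calc (k : ℝ) * Real.exp (-lam) ≤ k * Real.exp (-(Real.log k + Real.log (R / δ))) := by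
          gcongr
      _ = δ / R := by
          rw [Real.exp_neg, Real.exp_add, Real.exp_log (by linarith), Real.exp_log (by positivity)]
          field_simp
      _ ≤ δ / 4 := by gcongr; linarith
      _ = _ := by ring
  · have hu2 : (2 : ℝ) ≤ u := by exact_mod_cast (by omega : 2 ≤ u)
    refine (mul_le_mul_of_nonneg_right (choose_le_exp_mul_log hu huk) (Real.exp_pos _).le).trans ?_
    have e : δ / 2 * (1 / 2 : ℝ) ^ u = Real.exp (Real.log δ - (u + 1) * Real.log 2) := by
      rw [Real.exp_sub, Real.exp_log hδ, mul_comm ((u : ℝ) + 1), Real.exp_mul,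
        Real.exp_log (by norm_num)]
      have : (2 : ℝ) ^ ((u : ℝ) + 1) = 2 ^ u * 2 := by
        rw [Real.rpow_add_one (by norm_num), Real.rpow_natCast]
      rw [this, one_div, inv_pow]
      field_simp
    rw [e, ← Real.exp_add, Real.exp_le_exp]
    have hlogR : 4 ≤ Real.log R := by
      have h1 : Real.log 128 = 7 * Real.log 2 := by
        rw [show (128 : ℝ) = 2 ^ 7 by norm_num, Real.log_pow]; norm_num
      have h2 : Real.log 128 ≤ Real.log R := Real.log_le_log (by norm_num) hR
      have := Real.log_two_gt_d9
      linarith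
    have hlogδ : Real.log δ < 0 := Real.log_neg hδ hδ1
    have hlog2 : Real.log 2 < 1 := by have := Real.log_two_lt_d9; linarith
    rw [Real.log_div (by linarith) hδ.ne'] at hlam
    have h1 := mul_le_mul_of_nonneg_left hlam (by linarith : (0 : ℝ) ≤ u)
    have h2 : (u : ℝ) * 4 ≤ u * Real.log R := by gcongr
    have h3 : (u : ℝ) * Real.log δ ≤ 2 * Real.log δ := by nlinarith
    have h4 : ((u : ℝ) + 1) * Real.log 2 ≤ (u + 1) * 1 := by gcongr
    nlinarith

/-- The first moment bound when the spike is at a degree of at least four. -/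
lemma sum_le_of_four_mul_le (hc : 0 < c) (hk : 16 ≤ k) (hδ : 0 < δ) (hδ1 : δ < 1)
    (hRk : 4 * solitonR k c δ ≤ k) (hM : 7 ≤ M)
    (hn : k + M * (solitonR k c δ * Real.log (k / δ)) ≤ n)
    (hk1 : 256 ≤ c ^ 2 * Real.log k) (hk2 : 2048 ≤ c * √k) :
    ∃ j : ℕ → ℕ, (∀ u ∈ Finset.Icc 1 k, j u ≤ u) ∧
      ∑ u ∈ Finset.Icc 1 k, (k.choose (j u) : ℝ) / (u.choose (j u)) *
        Real.exp (-(j u * (n * hitProb k c δ (k - u)))) ≤ δ := by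
  have hk' : (16 : ℝ) ≤ k := by exact_mod_cast hk
  have hR0 := solitonR_pos hc (by omega) hδ hδ1 (k := k)
  have hLk := log_natCast_le (k := k) (by omega) hδ hδ1
  have hL2 : 2 ≤ Real.log (k / δ) := by
    refine le_trans ?_ (hLk.trans' (Real.log_le_log (by norm_num) hk'))
    have h1 : Real.log 16 = 4 * Real.log 2 := by
      rw [show (16 : ℝ) = 2 ^ 4 by norm_num, Real.log_pow]; norm_num
    have := Real.log_two_gt_d9
    linarith
  have hβ : 0 < beta k c δ := by linarith [half_le_beta (by omega) hR0 hδ hδ1]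
  have hnβ := add_two_mul_le_div_beta (by omega) hR0 hRk hδ hδ1 (by linarith) hM hn
  have hRdef : solitonR k c δ = c * √k * Real.log (k / δ) := rfl
  have hRL : 2048 * Real.log (k / δ) ≤ solitonR k c δ := by rw [hRdef]; gcongr
  have hRL2 : 256 * (Real.log (k / δ) * k) ≤ solitonR k c δ ^ 2 := by
    have h1 : solitonR k c δ ^ 2 =
        c ^ 2 * Real.log (k / δ) * (Real.log (k / δ) * k) := by
      rw [hRdef, mul_pow, mul_pow, Real.sq_sqrt (by positivity)]; ring
    rw [h1]
    gcongr
    exact hk1.trans (by gcongr)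
  have hθ := theta_nonneg hR0 (by linarith) hδ
  set L := Real.log (k / δ) with hLdef
  set R := solitonR k c δ with hRR
  have hR128 : 128 ≤ R := by linarith
  have hlam : ∀ u ∈ Finset.Icc 1 k, ∀ E : ℝ, 0 ≤ E →
      1 / k * E ≤ ∑ d ∈ Finset.Icc 1 k, theta k c δ d * (((k - u).choose (d - 1) : ℝ) / k.choose d) →
      Real.log (k / u) + (k + 2 * R) / k * E ≤ n * hitProb k c δ (k - u) := by
    intro u hu E hE0 hE
    obtain ⟨hu1, huk⟩ := Finset.mem_Icc.1 hu
    have hu1' : (1 : ℝ) ≤ u := by exact_mod_cast hu1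
    have huk' : (u : ℝ) ≤ k := by exact_mod_cast huk
    have h1 := le_hitProb_ideal (by omega) hβ (k - u) (by omega) hE
    have h2 := log_div_le_sum_inv (k := k) (k - u) (by omega)
    rw [Nat.cast_sub huk, sub_sub_cancel] at h2
    have h3 : 0 ≤ Real.log (k / u) := Real.log_nonneg (by rw [le_div_iff₀ (by linarith)]; linarith)
    set S := ∑ i ∈ Finset.range (k - u + 1), 1 / ((k : ℝ) - i) with hS
    calc Real.log (k / u) + (k + 2 * R) / k * E
        ≤ (k + 2 * R) / k * Real.log (k / u) + (k + 2 * R) / k * E := by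
          have : 1 * Real.log (k / u) ≤ (k + 2 * R) / k * Real.log (k / u) := by
            gcongr
            rw [le_div_iff₀ (by linarith)]; linarith
          linarith
      _ = (k + 2 * R) * (1 / k * Real.log (k / u) + 1 / k * E) := by ring
      _ ≤ n / beta k c δ * (1 / k * S + 1 / k * E) := by gcongr
      _ = n * ((1 / k * S + 1 / k * E) / beta k c δ) := by ring
      _ ≤ _ := by gcongr
  have hDpos : 4 ≤ ⌊k / R⌋₊ := Nat.le_floor (by rw [le_div_iff₀ hR0]; push_cast; linarith)
  have hDR : (⌊k / R⌋₊ : ℝ) ≤ k / R := Nat.floor_le (by positivity)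
  have hDR' : k / R - 1 ≤ (⌊k / R⌋₊ : ℝ) := by
    have := Nat.lt_floor_add_one (k / R); linarith
  have hDk : ⌊k / R⌋₊ ≤ k := by
    have h1 : k / R ≤ k := div_le_self (by linarith) (by linarith)
    exact_mod_cast hDR.trans h1
  have hlogR : 0 ≤ Real.log (R / δ) :=
    Real.log_nonneg (by rw [le_div_iff₀ hδ]; linarith)
  have hspike : ∀ u ∈ Finset.Icc 1 k, ∀ r : ℝ, 0 ≤ r →
      r ≤ ((k - u).choose (⌊k / R⌋₊ - 1) : ℝ) / (k - 1).choose (⌊k / R⌋₊ - 1) →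
      Real.log (k / u) + r * Real.log (R / δ) ≤ n * hitProb k c δ (k - u) := by
    intro u hu r hr0 hr
    refine le_trans ?_ (hlam u hu (R * ⌊k / R⌋₊ / k * (r * Real.log (R / δ))) (by positivity) ?_)
    -- Rounding loses a factor `1 - R / k` at worst, and `(1 + 2 * x) * (1 - x) ≥ 1` for `0 ≤ x ≤ 1
    -- / 2`.
    · have h1 : 1 ≤ (k + 2 * R) / k * (R * ⌊k / R⌋₊ / k) := by
        have h2 : 1 - R / k ≤ R * ⌊k / R⌋₊ / k := by
          calc 1 - R / k = R * (k / R - 1) / k := by field_simp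
            _ ≤ _ := by gcongr
        have h3 : (k + 2 * R) / k = 1 + 2 * (R / k) := by field_simp
        have h4 : R / k ≤ 1 / 4 := by
          rw [div_le_div_iff₀ (by linarith) (by norm_num)]; linarith
        have h5 : 0 < R / k := by positivity
        rw [h3]
        calc (1 : ℝ) ≤ (1 + 2 * (R / k)) * (1 - R / k) := by nlinarith
          _ ≤ _ := by gcongr
      have h2 : 1 * (r * Real.log (R / δ)) ≤
          (k + 2 * R) / k * (R * ⌊k / R⌋₊ / k) * (r * Real.log (R / δ)) := by gcongr
      linarith
    · refine le_trans ?_ (Finset.single_le_sum (f := fun d => theta k c δ d *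
        (((k - u).choose (d - 1) : ℝ) / k.choose d))
        (fun d _ => mul_nonneg (hθ d) (by positivity)) (Finset.mem_Icc.2 ⟨by omega, hDk⟩))
      have hθD : theta k c δ ⌊k / R⌋₊ = R / k * Real.log (R / δ) := theta_floor
      obtain ⟨d, hd⟩ : ∃ d, ⌊k / R⌋₊ = d + 1 := ⟨⌊k / R⌋₊ - 1, by omega⟩
      simp only [hθD]
      rw [hd, Nat.add_sub_cancel, choose_div_choose_eq (by omega)]
      rw [hd, Nat.add_sub_cancel] at hr
      calc 1 / k * (R * ((d + 1 : ℕ) : ℝ) / k * (r * Real.log (R / δ))) =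
          R / k * Real.log (R / δ) * ((d + 1) / k * r) := by push_cast; ring
        _ ≤ _ := by gcongr
  refine ⟨fun u => if (u : ℝ) ≤ R / 8 then u else ⌊min (u : ℝ) R / 8⌋₊, fun u hu => ?_,
    sum_le_of_term_le (by omega) hδ hδ1 fun u hu => ?_⟩
  · simp only
    split_ifs
    · exact le_rfl
    · have h1 : min (u : ℝ) R / 8 ≤ u := by
        have := min_le_left (u : ℝ) R
        have : (0 : ℝ) ≤ u := by positivity
        linarith
      have h2 := Nat.floor_le_floor h1
      rwa [Nat.floor_natCast] at h2
  · obtain ⟨hu1, huk⟩ := Finset.mem_Icc.1 hu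
    have hu1' : (1 : ℝ) ≤ u := by exact_mod_cast hu1
    have huk' : (u : ℝ) ≤ k := by exact_mod_cast huk
    by_cases hsmall : (u : ℝ) ≤ R / 8
    · simp only [if_pos hsmall]
      have key := term_le_of_le (lam := n * hitProb k c δ (k - u)) hu1 huk hδ hδ1 hR128 ?_ ?_
      · exact key.trans (le_add_of_nonneg_right (Real.exp_pos _).le)
      · rintro rfl
        have h := hspike 1 hu 1 zero_le_one ?_
        · simpa using h
        · rw [div_self]
          have : 0 < (k - 1).choose (⌊k / R⌋₊ - 1) := Nat.choose_pos (by omega)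
          exact_mod_cast this.ne'
      · refine hspike u hu (3 / 4) (by norm_num) ?_
        have h6 := one_sub_le_choose_div_choose (d := ⌊k / R⌋₊ - 1) (by omega) hu1 huk (by omega)
        refine le_trans ?_ h6
        rw [Nat.cast_sub (by omega)]
        push_cast
        -- The threshold `R / 8` for `u` and the degree at most `k / R` have product `k / 8`.
        have h7 : ((u : ℝ) - 1) * (⌊k / R⌋₊ - 1) / (k - 1) ≤ 1 / 4 := by
          rw [div_le_div_iff₀ (by linarith) (by norm_num)]
          have h8 : ((u : ℝ) - 1) * (⌊k / R⌋₊ - 1) ≤ R / 8 * (k / R) := by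
            have : (4 : ℝ) ≤ ⌊k / R⌋₊ := by exact_mod_cast hDpos
            refine mul_le_mul (by linarith) (by linarith) (by linarith) (by positivity)
          have h9 : R / 8 * (k / R) = k / 8 := by field_simp
          linarith
        linarith
    · simp only [if_neg hsmall]
      push Not at hsmall
      refine (term_le_of_lt hu1 huk hR128 hsmall hRL hRL2 ?_).trans
        (le_add_of_nonneg_left (by positivity))
      have hE := le_sum_theta (by omega) hR0 hRk hθ hu1 huk
      have hE0 : 0 ≤ R / (4 * max (u : ℝ) R) := by
        have : 0 < max (u : ℝ) R := lt_max_of_lt_right hR0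
        positivity
      refine le_trans ?_ (hlam u hu _ hE0 hE)
      have : 1 * (R / (4 * max (u : ℝ) R)) ≤ (k + 2 * R) / k * (R / (4 * max (u : ℝ) R)) := by
        gcongr
        rw [le_div_iff₀ (by linarith)]; linarith
      linarith

end LargeRegime

end SeF

namespace SeF

/-- The first moment bound holds with `k + C √k ln² (k / δ)` droplets. -/
theorem exists_sum_le (c : ℝ) (hc : 0 < c) :
    ∃ C : ℝ, 0 < C ∧ ∀ (k n : ℕ) (δ : ℝ), 2 ≤ k → 0 < δ → δ < 1 →
      (k + C * (√k * Real.log (k / δ) ^ 2) : ℝ) ≤ n →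
      ∃ j : ℕ → ℕ, (∀ u ∈ Finset.Icc 1 k, j u ≤ u) ∧
        ∑ u ∈ Finset.Icc 1 k, (k.choose (j u) : ℝ) / (u.choose (j u)) *
          Real.exp (-(j u * (n * hitProb k c δ (k - u)))) ≤ δ := by
  have hlog : Filter.Tendsto (fun k : ℕ => c ^ 2 * Real.log k) Filter.atTop Filter.atTop :=
    (Real.tendsto_log_atTop.comp tendsto_natCast_atTop_atTop).const_mul_atTop (by positivity)
  have hsqrt : Filter.Tendsto (fun k : ℕ => c * √(k : ℝ)) Filter.atTop Filter.atTop :=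
    (Real.tendsto_sqrt_atTop.comp tendsto_natCast_atTop_atTop).const_mul_atTop hc
  -- `K` depends on `c` only. Beyond it, `R ≥ 2048 * L` and `R ^ 2 ≥ 256 * L * k`, as the main
  -- regime requires.
  obtain ⟨K, hK⟩ := Filter.eventually_atTop.1
    (((hlog.eventually_ge_atTop 256).and (hsqrt.eventually_ge_atTop 2048)).and
      (Filter.eventually_ge_atTop 16))
  set M : ℝ := 1024 + 512 / c with hM
  have hM0 : 1024 ≤ M := by
    have : 0 ≤ 512 / c := by positivity
    linarith
  -- The first summand serves `k < K`; the second turns the overhead into `M * R * L`, because `R =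
  -- c * √k * L`.
  refine ⟨15 * (K : ℝ) ^ 2 + c * M, by positivity, fun k n δ hk hδ hδ1 hn => ?_⟩
  have hk' : (2 : ℝ) ≤ k := by exact_mod_cast hk
  have hR0 := solitonR_pos hc (by omega) hδ hδ1 (k := k)
  have hL := log_div_pos (k := k) (by omega) hδ hδ1
  have hkL := le_exp_log_div (k := k) (by omega) hδ hδ1
  have hn1 : k + M * (solitonR k c δ * Real.log (k / δ)) ≤ n := by
    refine le_trans ?_ hn
    have e : M * (solitonR k c δ * Real.log (k / δ)) =
        c * M * (√k * Real.log (k / δ) ^ 2) := by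
      rw [solitonR]; ring
    rw [e, add_mul]
    have : 0 ≤ 15 * (K : ℝ) ^ 2 * (√k * Real.log (k / δ) ^ 2) := by positivity
    linarith
  have of_self : (∀ u ∈ Finset.Icc 1 k, (k.choose u : ℝ) / u.choose u *
      Real.exp (-(u * (n * hitProb k c δ (k - u)))) ≤ Real.exp (-(2 * Real.log (k / δ)))) →
      ∃ j : ℕ → ℕ, (∀ u ∈ Finset.Icc 1 k, j u ≤ u) ∧
        ∑ u ∈ Finset.Icc 1 k, (k.choose (j u) : ℝ) / (u.choose (j u)) *
          Real.exp (-(j u * (n * hitProb k c δ (k - u)))) ≤ δ := fun h =>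
    ⟨fun u => u, fun _ _ => le_rfl, sum_le_of_term_le hk hδ hδ1 fun u hu =>
      (h u hu).trans (le_add_of_nonneg_left (by positivity))⟩
  rcases lt_or_ge (k : ℝ) (solitonR k c δ) with hR | hR
  · exact of_self fun u hu => term_le_of_lt_solitonR hc hk hδ hδ1 hR (by linarith) hn1 hu
  rcases lt_or_ge k K with hkK | hkK
  · refine of_self fun u hu => term_self_le_of_three_mul_le hkL hL.le (Finset.mem_Icc.1 hu).1 ?_
    refine three_mul_le_of_le hc hk hδ hδ1 hR (K := K) (by exact_mod_cast hkK.le) ?_ _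
    refine le_trans ?_ hn
    rw [add_mul]
    have : 0 ≤ c * M * (√k * Real.log (k / δ) ^ 2) := by positivity
    linarith
  obtain ⟨⟨hk1, hk2⟩, hk16⟩ := hK k hkK
  rcases lt_or_ge (k : ℝ) (4 * solitonR k c δ) with hR4 | hR4
  · exact of_self fun u hu => term_le_of_le_four_mul hc hk16 hδ hδ1 hR hR4 le_rfl hn1 hu
  · exact sum_le_of_four_mul_le hc hk16 hδ hδ1 hR4 (by linarith) hn1 hk1 hk2

end SeF
theorem mainTheorem2 (c : ℝ) (hc : 0 < c) :
    ∃ C : ℝ, 0 < C ∧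
      ∀ (k s : ℕ) (δ : ℝ), 1 ≤ k → 1 ≤ s → 0 < δ → δ < 1 →
      -- the hash function, the format of the blocks, and the blockchain
      ∀ (h w q e : ℕ) (hash : List (ZMod 2) → (Fin h → ZMod 2))
        (txs : (Fin q → ZMod 2) ↪ List (List (ZMod 2))) (B : ℕ → SeF.Block h w q),
        SeF.IsBlockchain hash txs (e * k) B →
      -- the droplet nodes and the private coins with which they choose neighbours
      ∀ (J : Type*) [Fintype J] [DecidableEq J] (Ω : Type*) [MeasurableSpace Ω]
        (P : Measure Ω) [IsProbabilityMeasure P] (V : J × Fin s → Ω → Finset (Fin k)),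
        (∀ i, HasLaw (V i) (SeF.neighborLaw k c δ) P) →
        iIndepFun V P →
      -- the contacted nodes `T` and the controlled nodes `A`, chosen obliviously
      ∀ T A : Ω → Finset J, Measurable T → Measurable A →
        IndepFun (fun ω => (T ω, A ω)) (fun ω i => V i ω) P →
        (∀ᵐ ω ∂P, (1 / s : ℝ) * (k + C * (√k * Real.log (k / δ) ^ 2)) ≤ ((T ω \ A ω).card : ℝ)) →
      -- what the controlled nodes send, possibly depending on everything
      ∀ adv : Ω → Fin e → J × Fin s → Option (SeF.Droplet h w q k),
        P {ω | ¬ SeF.RecoversChain hash txs e B (T ω) (A ω) (fun i => V i ω) (adv ω)} ≤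
          ENNReal.ofReal δ + P {ω | SeF.ExhibitsCollision hash txs e B (T ω) (A ω) (adv ω)} := by
  obtain ⟨C, hC, h⟩ := SeF.exists_sum_le c hc
  refine ⟨C, hC, ?_⟩
  intro k s δ hk hs hδ hδ1 h' w q e hash txs B hB J _ _ Ω _ P _ V hV hind T A hT hA hTA hN adv
  refine SeF.prob_not_recoversChain_le hB hT hA hTA hs hN (fun I hI => ?_) adv
  have hk' : (1 : ℝ) ≤ k := by exact_mod_cast hk
  have hI0 : I.Nonempty := by
    have h0 : 0 ≤ C * (√k * Real.log (k / δ) ^ 2) := by positivity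
    have h1 : (0 : ℝ) < I.card := by linarith
    exact Finset.card_pos.1 (by exact_mod_cast h1)
  -- The first moment bound needs `k ≥ 2`; with a single block one honest droplet is enough almost
  -- surely.
  rcases eq_or_lt_of_le hk with rfl | hk2
  · rw [SeF.prob_hasStoppingSet_one hV I hI0]
    exact zero_le
  · obtain ⟨j, hj, hsum⟩ := h k I.card δ hk2 hδ hδ1 hI
    exact (SeF.prob_hasStoppingSet_le_exp hk hV hind I hI0 j hj).trans
      (ENNReal.ofReal_le_ofReal hsum)
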